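/- **Setting.** Let $G=(V,E)$ be a finite connected graph with edge costs $c_e\ge 0$ and shortest-path distance $d$. In *soft-capacitated facility location* every vertex $v$ has an opening cost $f_v>0$ and a capacity $\beta_v\in\{1,2,\dots\}$. Requests $R=(r_1,\dots,r_{|R|})$ (vertices, repetitions allowed) arrive one by one; any number of facilities may be opened at $v$, each at cost $f_v$ and each serving at most $\beta_v$ requests; each request is connected on arrival to a facility, at the cost of its distance. $\mathrm{OPT}$ is the least total cost of a (offline) solution. A prediction $\hat R=(\hat r_1,\dots,\hat r_{|\hat R|})$ is given in advance. A pair $(\Delta,D)$ is an *error* if there are subsequences $M\subseteq R$, $\hat M\subseteq\hat R$ of equal size such that the minimum-cost perfect matching between $M$ and $\hat M$ (with respect to $d$) costs $D$ and $|R\setminus M|+|\hat R\setminus\hat M|=\Delta$. **Reduction.** Let $G'$ arise from $G$ by adding for each $v\in V$ a copy $v'$ and an edge $(v,v')$ of cost $f_v/\beta_v$. In the uncapacitated facility location instance $\mathcal I'$ on $G'$, the opening cost is $f_v$ at $v'$ and $\infty$ at $v$; requests and predictions stay at their vertices in $V$. $\mathrm{OPT}'$ is the optimal cost of $\mathcal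 I'$. Below, $d$ and $f$ refer to $\mathcal I'$. **Online component** $\mathrm{ON}$ (run with given opening costs $f$). It keeps a set $F$ of open facilities, the list $L$ of its requests, and potentials $p$; initially $F=L=\emptyset$, $p=0$, and $d(\emptyset,r)=\infty$. On request $r$: append $r$ to $L$; add $(d(F,r)-d(v,r))_+$ to $p(v)$ for all $v$; let $w$ maximize $p(v)-f_v$; if $p(w)>f_w$, add $w$ to $F$ and reset $p(v):=\sum_{q\in L}(d(F,q)-d(v,q))_+$ for all $v$. (When $F=\emptyset$, this opens a $w$ that minimizes $f_v+d(v,r)$.) The *amortized cost* of $r$ is $2\min\{d(F,r),\min_v(f_v-p(v)+d(v,r))\}$, with $F,p$ taken before $r$ is handled. **Prize-collecting component** $\mathrm{PC}$. For requests $Q$ with penalties $\pi>0$, a solution $S$ consists of open facilities and an assignment of some (the satisfied) requests to them; $c(S)$ is its opening plus connection cost, and its value is $c(S)$ plus the penalties of the unsatisfied requests. $\mathrm{PC}$ is any $\gamma$-approximation for minimizing this value, where $\gamma\ge1$. For an integer $0\le u\le|\hat R|$, $\mathrm{Partial}(\hat R,u)$ is the empty solution if $\gamma u\ge|\hat R|$;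 otherwise let $i$ be the least integer such that $S_2=\mathrm{PC}(\hat R,2^i)$ (all penalties $2^i$) leaves at most $\gamma u$ requests unsatisfied, let $S_1=\mathrm{PC}(\hat R,2^{i-1})$, let $u_1,u_2$ be the numbers of requests unsatisfied by $S_1,S_2$, and return $S_1$ if $\gamma u\ge(u_1+u_2)/2$ and $S_2$ otherwise. **Algorithm for $\mathcal I'$.** Start with $B=\hat B=0$, no open facilities, and a new instance of $\mathrm{ON}$. On request $r$: give $r$ to $\mathrm{ON}$, open the facility it opens (if any), add the amortized cost of $r$ to $B$, and connect $r$ to its closest open facility. If now $B\ge2\hat B$: set $\hat B:=B$, take the least $u\in\{0,\dots,|\hat R|\}$ with $c(\mathrm{Partial}(\hat R,u))\le3\gamma\hat B$, open all facilities of $\mathrm{Partial}(\hat R,u)$, and start a new instance of $\mathrm{ON}$ in which all open facilities have opening cost $0$. Let $\mathrm{ALG}'$ be the total opening plus connection cost in $\mathcal I'$. **Algorithm for the soft-capacitated instance.** Run the algorithm for $\mathcal I'$. When it opens $v'$, open a facility at $v$; when it connects $r$ to $v'$, connect $r$ to a facility at $v$, opening an additional one there if all are full. Let $\mathrm{ALG}$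 be its total cost. **Theorem.** For every $\gamma\ge1$ there is a constant $C>0$, depending only on $\gamma$, such that for every instance, every $\gamma$-approximation $\mathrm{PC}$, every prediction $\hat R$ and every request sequence $R$: both algorithms produce feasible solutions, $\mathrm{ALG}\le\mathrm{ALG}'$, $\mathrm{OPT}'\le2\,\mathrm{OPT}$, and for every error $(\Delta,D)$ $$\mathrm{ALG}\le C\,\log\bigl(\min\{|R|,\Delta\}+2\bigr)\cdot\mathrm{OPT}+C\cdot D .$$ -/

import Mathlib

/-! ### Weighted graphs and shortest-path distances -/

/-- A connected undirected graph with nonnegative edge costs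
(only the values of `cost` on edges matter). -/
structure Network (V : Type*) where
  graph : SimpleGraph V
  connected : graph.Connected
  cost : V → V → ℝ
  cost_symm : ∀ u v, cost u v = cost v u
  cost_nonneg : ∀ u v, 0 ≤ cost u v

namespace Network

variable {V : Type*} (N : Network V)

/-- Total cost of the edges of a walk. -/
noncomputable def walkCost : {u v : V} → N.graph.Walk u v → ℝ
  | _, _, .nil => 0
  | _, _, .cons (u := u) (v := w) _ p => N.cost u w + walkCost p

/-- Shortest-path distance. -/
noncomputable def dist (u v : V) : ℝ := ⨅ p : N.graph.Walk u v, N.walkCost p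

/-- Distance `d(F, r)` from a vertex to a nonempty set of vertices. It is only used for nonempty
`F`; wherever `d(∅, r) = ∞` is meant, the case `F = ∅` is treated explicitly. -/
noncomputable def distTo (F : Finset V) (r : V) : ℝ := ⨅ v : F, N.dist v r

end Network

/-- Metric error with outliers: `(Δ, D)` is an error of the prediction `Rhat` for the request
sequence `R` (requests and predictions are indexed, so that vertices may be repeated) if some
requests `M` and equally many predicted requests `Mhat` have minimum-cost matching of cost `D`, and
exactly `Δ` requests and predicted requests are left over. -/
def IsMetricError {V : Type*} (N : Network V) {n m : ℕ} (R : Fin n → V) (Rhat : Fin m → V)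
    (Δ : ℕ) (D : ℝ) : Prop :=
  ∃ (M : Finset (Fin n)) (Mhat : Finset (Fin m)),
    M.card = Mhat.card ∧
    IsLeast {c : ℝ | ∃ σ : M ≃ Mhat, c = ∑ r : M, N.dist (R r) (Rhat (σ r))} D ∧
    Mᶜ.card + Mhatᶜ.card = Δ

/-! ### Uncapacitated facility location -/

/-- An instance of uncapacitated facility location. Vertices in `sites` have the (finite, positive)
opening cost `openCost v`; vertices outside `sites` have opening cost `∞`, that is, no facility can
be opened there. -/
structure UFLInstance (W : Type*) extends Network W where
  sites : Finset W
  sites_nonempty : sites.Nonempty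
  openCost : W → ℝ
  openCost_pos : ∀ v, 0 < openCost v

/-- A solution serving all requests: a set of open facilities and an assignment of every request to
an open facility. -/
structure UFLSolution (W : Type*) (n : ℕ) where
  opened : Finset W
  assign : Fin n → W

namespace UFLSolution

variable {W : Type*} {n : ℕ}

def Feasible (I : UFLInstance W) (T : UFLSolution W n) : Prop :=
  T.opened ⊆ I.sites ∧ ∀ i, T.assign i ∈ T.opened

/-- Opening costs plus connection costs. -/
noncomputable def cost (I : UFLInstance W) (R : Fin n → W) (T : UFLSolution W n) : ℝ :=
  ∑ v ∈ T.opened, I.openCost v + ∑ i, I.dist (R i) (T.assign i)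

end UFLSolution

/-- The optimal cost of an uncapacitated instance. -/
noncomputable def UFLInstance.opt {W : Type*} (I : UFLInstance W) {n : ℕ} (R : Fin n → W) : ℝ :=
  sInf {c | ∃ T : UFLSolution W n, T.Feasible I ∧ c = T.cost I R}

/-! ### The prize-collecting version -/

/-- A solution of prize-collecting facility location for `m` requests: a set of open facilities and
an assignment of some of the requests to open facilities (`none`: the request is not satisfied). -/
structure PCSolution {W : Type*} (I : UFLInstance W) (m : ℕ) where
  opened : Finset W
  opened_subset : opened ⊆ I.sites
  assign : Fin m → Option W
  assign_mem : ∀ j v, assign j = some v → v ∈ opened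

namespace PCSolution

variable {W : Type*} {I : UFLInstance W} {m : ℕ}

/-- The solution that opens nothing and satisfies nothing. -/
def empty (I : UFLInstance W) (m : ℕ) : PCSolution I m where
  opened := ∅
  opened_subset := Finset.empty_subset _
  assign := fun _ => none
  assign_mem := by simp

/-- The requests that are not satisfied. -/
def unsatisfied (T : PCSolution I m) : Finset (Fin m) :=
  Finset.univ.filter fun j => (T.assign j).isNone

/-- `c(T)`: opening costs plus connection costs of the satisfied requests. -/
noncomputable def cost (Q : Fin m → W) (T : PCSolution I m) : ℝ :=
  ∑ v ∈ T.opened, I.openCost v + ∑ j, ((T.assign j).map fun v => I.dist (Q j) v).getD 0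

/-- The prize-collecting objective with penalties `π`. -/
noncomputable def value (Q : Fin m → W) (π : Fin m → ℝ) (T : PCSolution I m) : ℝ :=
  T.cost Q + ∑ j ∈ T.unsatisfied, π j

end PCSolution

/-- A procedure that returns a prize-collecting solution, given requests and their penalties. -/
abbrev PCAlgorithm {W : Type*} (I : UFLInstance W) : Type _ :=
  (m : ℕ) → (Fin m → W) → (Fin m → ℝ) → PCSolution I m

/-- `PC` is a `γ`-approximation for prize-collecting facility location. (A procedure that returns an
optimal solution is one for every `γ ≥ 1`.) -/
def PCAlgorithm.IsApprox {W : Type*} {I : UFLInstance W} (PC : PCAlgorithm I) (γ : ℝ) : Prop :=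
  ∀ (m : ℕ) (Q : Fin m → W) (π : Fin m → ℝ), (∀ j, 0 < π j) →
    ∀ T : PCSolution I m, (PC m Q π).value Q π ≤ γ * T.value Q π

/-- The subroutine `Partial(Rhat, u)` of the framework. -/
noncomputable def partialSol {W : Type*} {I : UFLInstance W} (PC : PCAlgorithm I) (γ : ℝ)
    {m : ℕ} (Rhat : Fin m → W) (u : ℕ) : PCSolution I m :=
  open scoped Classical in
  if (m : ℝ) ≤ γ * u then PCSolution.empty I m
  else
    let sol : ℤ → PCSolution I m := fun i => PC m Rhat fun _ => (2 : ℝ) ^ i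
    let i : ℤ := sInf {i : ℤ | ((sol i).unsatisfied.card : ℝ) ≤ γ * u}
    if (((sol (i - 1)).unsatisfied.card : ℝ) + ((sol i).unsatisfied.card : ℝ)) / 2 ≤ γ * u
    then sol (i - 1) else sol i

/-- The least `u ∈ {0, …, |Rhat|}` with `c(Partial(Rhat, u)) ≤ 3γ · b`. -/
noncomputable def leastU {W : Type*} {I : UFLInstance W} (PC : PCAlgorithm I) (γ : ℝ)
    {m : ℕ} (Rhat : Fin m → W) (b : ℝ) : ℕ :=
  sInf {u : ℕ | u ≤ m ∧ (partialSol PC γ Rhat u).cost Rhat ≤ 3 * γ * b}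

/-! ### The online algorithm for uncapacitated facility location -/

/-- An element of the nonempty finite set `s` at which `g` is smallest. -/
noncomputable def argMin {W : Type*} [Nonempty W] (s : Finset W) (g : W → ℝ) : W :=
  Classical.epsilon fun w => w ∈ s ∧ ∀ v ∈ s, g w ≤ g v

/-- State of the online algorithm: open facilities `F`, requests so far `L`, potentials `p`. -/
structure OnlineState (W : Type*) where
  F : Finset W
  L : List W
  p : W → ℝ

namespace OnlineState

variable {W : Type*}

/-- The state of a new instance of the online algorithm. -/
def init (W : Type*) : OnlineState W := ⟨∅, [], fun _ => 0⟩

/-- `ComputeNewPotentials`. -/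
noncomputable def newPotentials (I : UFLInstance W) (F : Finset W) (L : List W) (v : W) : ℝ :=
  (L.map fun q => max (I.distTo F q - I.dist v q) 0).sum

/-- One step of the online algorithm, run with opening costs `f`.
If `F = ∅`, then `d(F, r) = ∞`: all potentials become `∞ - d(v, r)`, so that some facility is
opened, and the maximizer of `p(v) - f v` is the minimizer of `f v + d(v, r)`. -/
noncomputable def step (I : UFLInstance W) (f : W → ℝ) (s : OnlineState W) (r : W) :
    OnlineState W :=
  open scoped Classical in
  haveI : Nonempty W := I.connected.nonempty
  if s.F = ∅ then
    let w := argMin I.sites fun v => f v + I.dist v r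
    ⟨{w}, r :: s.L, newPotentials I {w} (r :: s.L)⟩
  else
    let p' : W → ℝ := fun v => s.p v + max (I.distTo s.F r - I.dist v r) 0
    let w := argMin I.sites fun v => -(p' v - f v)
    if f w < p' w then
      ⟨insert w s.F, r :: s.L, newPotentials I (insert w s.F) (r :: s.L)⟩
    else ⟨s.F, r :: s.L, p'⟩

/-- The amortized cost `2 · min {d(F, r), min_v (f v - p v + d(v, r))}` of the request `r` that
arrives in state `s`, where `d(∅, r) = ∞`. -/
noncomputable def amortizedCost (I : UFLInstance W) (f : W → ℝ) (s : OnlineState W) (r : W) : ℝ :=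
  open scoped Classical in
  let a : ℝ := ⨅ v : I.sites, (f v - s.p v + I.dist v r)
  if s.F = ∅ then 2 * a else 2 * min (I.distTo s.F r) a

end OnlineState

/-! ### The framework for online algorithms with predictions -/

/-- State of the framework: the online (amortized) cost `B`, its value `Bhat` when the last offline
solution was bought, the set `S` of open facilities, the set `Z` of facilities whose cost is zero
in the current instance of the online algorithm, and the state of that instance. -/
structure FrameworkState (W : Type*) where
  B : ℝ
  Bhat : ℝ
  S : Finset W
  Z : Finset W
  on : OnlineState W

namespace FrameworkState

variable {W : Type*}

def init (W : Type*) : FrameworkState W := ⟨0, 0, ∅, ∅, OnlineState.init W⟩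

/-- Opening costs in the current instance of the online algorithm. -/
noncomputable def currentCost (I : UFLInstance W) (s : FrameworkState W) (v : W) : ℝ :=
  open scoped Classical in if v ∈ s.Z then 0 else I.openCost v

/-- The current instance of the online algorithm after it has handled `r`. -/
noncomputable def onAfter (I : UFLInstance W) (s : FrameworkState W) (r : W) : OnlineState W :=
  s.on.step I (s.currentCost I) r

/-- All open facilities after the online algorithm has handled `r`. -/
noncomputable def openAfter (I : UFLInstance W) (s : FrameworkState W) (r : W) : Finset W :=
  open scoped Classical in s.S ∪ (s.onAfter I r).F

/-- The closest open facility, to which the request `r` that arrives in state `s` is connected. -/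
noncomputable def target (I : UFLInstance W) (s : FrameworkState W) (r : W) : W :=
  haveI : Nonempty W := I.connected.nonempty
  argMin (s.openAfter I r) fun v => I.dist v r

/-- One iteration of the framework. -/
noncomputable def step (I : UFLInstance W) (PC : PCAlgorithm I) (γ : ℝ) {m : ℕ} (Rhat : Fin m → W)
    (s : FrameworkState W) (r : W) : FrameworkState W :=
  open scoped Classical in
  let B' := s.B + s.on.amortizedCost I (s.currentCost I) r
  let S' := s.openAfter I r
  if 2 * s.Bhat ≤ B' then
    let S'' := S' ∪ (partialSol PC γ Rhat (leastU PC γ Rhat B')).opened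
    ⟨B', B', S'', S'', OnlineState.init W⟩
  else ⟨B', s.Bhat, S', s.Z, s.onAfter I r⟩

end FrameworkState

/-- The state of the framework after the first `t` requests. -/
noncomputable def frameworkState {W : Type*} (I : UFLInstance W) (PC : PCAlgorithm I) (γ : ℝ)
    {m : ℕ} (Rhat : Fin m → W) {n : ℕ} (R : Fin n → W) : ℕ → FrameworkState W
  | 0 => FrameworkState.init W
  | t + 1 =>
    if h : t < n then (frameworkState I PC γ Rhat R t).step I PC γ Rhat (R ⟨t, h⟩)
    else frameworkState I PC γ Rhat R t

/-- The facility to which the framework connects the `i`-th request on its arrival. -/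
noncomputable def frameworkTarget {W : Type*} (I : UFLInstance W) (PC : PCAlgorithm I) (γ : ℝ)
    {m : ℕ} (Rhat : Fin m → W) {n : ℕ} (R : Fin n → W) (i : Fin n) : W :=
  (frameworkState I PC γ Rhat R i).target I (R i)

/-- The solution built by the algorithm for uncapacitated facility location with predictions. -/
noncomputable def uflAlgorithm {W : Type*} (I : UFLInstance W) (PC : PCAlgorithm I) (γ : ℝ)
    {m : ℕ} (Rhat : Fin m → W) {n : ℕ} (R : Fin n → W) : UFLSolution W n where
  opened := (frameworkState I PC γ Rhat R n).S
  assign := frameworkTarget I PC γ Rhat R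

/-! ### Soft-capacitated facility location -/

/-- An instance of soft-capacitated facility location: any number of facilities can be opened at
`v`, each at cost `openCost v`, and each of them serves at most `capacity v` requests. -/
structure SoftCapInstance (V : Type*) extends Network V where
  openCost : V → ℝ
  openCost_pos : ∀ v, 0 < openCost v
  capacity : V → ℕ
  capacity_pos : ∀ v, 0 < capacity v

/-- A solution: the number of facilities opened at every vertex, and the vertex at whose facilities
each request is served. -/
structure SoftCapSolution (V : Type*) (n : ℕ) where
  copies : V → ℕ
  assign : Fin n → V

namespace SoftCapSolution

variable {V : Type*} {n : ℕ}

def Feasible (I : SoftCapInstance V) (T : SoftCapSolution V n) : Prop :=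
  open scoped Classical in
  ∀ v, (Finset.univ.filter fun i => T.assign i = v).card ≤ T.copies v * I.capacity v

/-- Opening costs plus connection costs. -/
noncomputable def cost [Fintype V] (I : SoftCapInstance V) (R : Fin n → V)
    (T : SoftCapSolution V n) : ℝ :=
  ∑ v, (T.copies v : ℝ) * I.openCost v + ∑ i, I.dist (R i) (T.assign i)

end SoftCapSolution

/-- The optimal cost of a soft-capacitated instance. -/
noncomputable def SoftCapInstance.opt {V : Type*} [Fintype V] (I : SoftCapInstance V) {n : ℕ}
    (R : Fin n → V) : ℝ :=
  sInf {c | ∃ T : SoftCapSolution V n, T.Feasible I ∧ c = T.cost I R}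

/-! ### The reduction to the uncapacitated problem -/

namespace SoftCapInstance

variable {V : Type*} (I : SoftCapInstance V)

/-- The graph on `V ∪ V'` (`inl v` is `v`, and `inr v` is its copy `v'`) with the edges of the
original graph and the edges `(v, v')`. -/
def redGraph : SimpleGraph (V ⊕ V) where
  Adj
    | .inl u, .inl v => I.graph.Adj u v
    | .inl u, .inr v => u = v
    | .inr u, .inl v => u = v
    | .inr _, .inr _ => False
  symm := ⟨by
    rintro (u | u) (v | v) h
    · exact SimpleGraph.Adj.symm (G := I.graph) h
    · exact Eq.symm h
    · exact Eq.symm h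
    · exact h⟩
  loopless := ⟨by
    rintro (u | u) h
    · exact I.graph.loopless.irrefl u h
    · exact h⟩

/-- The old edge costs, and cost `f_v / β_v` on the edge `(v, v')`. -/
noncomputable def redCost : V ⊕ V → V ⊕ V → ℝ
  | .inl u, .inl v => I.cost u v
  | .inl _, .inr v => I.openCost v / I.capacity v
  | .inr v, .inl _ => I.openCost v / I.capacity v
  | .inr _, .inr _ => 0

theorem redGraph_connected : I.redGraph.Connected := by
  have hl : ∀ u v : V, I.redGraph.Reachable (.inl u) (.inl v) := by
    intro u v
    obtain ⟨p⟩ := I.connected.preconnected u v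
    induction p with
    | nil => exact SimpleGraph.Reachable.refl _
    | cons h _ ih =>
      exact SimpleGraph.Reachable.trans
        (SimpleGraph.Adj.reachable (G := I.redGraph) (u := .inl _) (v := .inl _) h) ih
  have hr : ∀ x : V ⊕ V, I.redGraph.Reachable x (.inl (Sum.elim id id x)) := by
    rintro (u | u)
    · exact SimpleGraph.Reachable.refl _
    · exact SimpleGraph.Adj.reachable (G := I.redGraph) (u := .inr u) (v := .inl u) rfl
  obtain ⟨v₀⟩ := I.connected.nonempty
  have : Nonempty (V ⊕ V) := ⟨.inl v₀⟩
  exact ⟨fun x y => ((hr x).trans (hl _ _)).trans (hr y).symm⟩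

/-- The uncapacitated instance on `V ∪ V'`: opening cost `f_v` at `v'`, and `∞` at `v`. -/
noncomputable def reduction [Fintype V] : UFLInstance (V ⊕ V) where
  graph := I.redGraph
  connected := I.redGraph_connected
  cost := I.redCost
  cost_symm := by
    rintro (u | u) (v | v) <;> simp [redCost, I.cost_symm u v]
  cost_nonneg := by
    rintro (u | u) (v | v) <;> simp only [redCost]
    · exact I.cost_nonneg u v
    · exact div_nonneg (I.openCost_pos v).le (Nat.cast_nonneg _)
    · exact div_nonneg (I.openCost_pos u).le (Nat.cast_nonneg _)
    · exact le_rfl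
  sites := Finset.univ.map Function.Embedding.inr
  sites_nonempty := by
    obtain ⟨v₀⟩ := I.connected.nonempty
    exact ⟨.inr v₀, by simp⟩
  openCost := Sum.elim I.openCost I.openCost
  openCost_pos := by
    rintro (v | v) <;> exact I.openCost_pos v

end SoftCapInstance

section SoftCapAlgorithm

variable {V : Type*} [Fintype V] (I : SoftCapInstance V) (PC : PCAlgorithm I.reduction) (γ : ℝ)
  {m : ℕ} (Rhat : Fin m → V) {n : ℕ} (R : Fin n → V)

/-- The algorithm for the uncapacitated problem, run on the reduced instance. -/
noncomputable def reducedAlgorithm : UFLSolution (V ⊕ V) n :=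
  uflAlgorithm I.reduction PC γ (Sum.inl ∘ Rhat) (Sum.inl ∘ R)

/-- The vertex `v` at which the `i`-th request is served: the one whose copy `v'` serves it in the
reduced instance. -/
noncomputable def softCapTarget (i : Fin n) : V :=
  Sum.elim id id ((reducedAlgorithm I PC γ Rhat R).assign i)

/-- The numbers of facilities opened at, and of requests connected to, every vertex after the first
`t` requests. When a request arrives, a facility is opened at `v` for every `v'` that is newly
opened in the reduced instance; then the request is connected, after an additional facility has been
opened at its target if all facilities there are full. -/
noncomputable def softCapState : ℕ → (V → ℕ) × (V → ℕ)
  | 0 => (fun _ => 0, fun _ => 0)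
  | t + 1 =>
    open scoped Classical in
    if h : t < n then
      let old := softCapState t
      let S := fun t => (frameworkState I.reduction PC γ (Sum.inl ∘ Rhat) (Sum.inl ∘ R) t).S
      let copies : V → ℕ := fun v =>
        old.1 v + if Sum.inr v ∈ S (t + 1) ∧ Sum.inr v ∉ S t then 1 else 0
      let x := softCapTarget I PC γ Rhat R ⟨t, h⟩
      (if copies x * I.capacity x ≤ old.2 x then Function.update copies x (copies x + 1)
        else copies,
       Function.update old.2 x (old.2 x + 1))
    else softCapState t

/-- The solution built by the algorithm for soft-capacitated facility location with predictions. -/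
noncomputable def softCapAlgorithm : SoftCapSolution V n where
  copies := (softCapState I PC γ Rhat R n).1
  assign := softCapTarget I PC γ Rhat R

end SoftCapAlgorithm

/-! The reduction charges each unit of capacity at `v` to the edge `(v, v')`. If `x` requests are
served at `v` by `k` facilities, then `x ≤ k * β_v`, so crossing the new edges costs at most `k *
f_v`: a soft-capacitated solution at most doubles in cost. Conversely, each full facility is paid
for by the `β_v` requests that cross `(v, v')`, and one more facility per vertex by the opening of
`v'`. It remains to bound the uncapacitated algorithm (`uflAlgorithm_cost_le`).

Its cost is at most `1 + 6γ` times the amortized cost `B`: the online component is paid for by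
`OnlineState.Valid.step_cost_le`, and the purchases of offline solutions form a geometric series
because `Bhat` at least doubles.

To bound `B`, let `T` be any solution for the requests, of cost `K`. The matching, of cost `D`,
turns `T` into a solution of cost at most `Y = K + D` that leaves only the unmatched predictions
unsatisfied. Unless `B` stays below `2Y`, some purchase happens with `B` between `Y` and `4Y`. The
solution bought then leaves at most `2γ` times the number of unmatched predictions unsatisfied and
costs at most `12γY`. From then on its facilities are free, and through the matching they are close
to all but `O(min {n, Δ})` requests.

In each later phase the close requests pay `O(D + γY)`. The others are compared with `T`: at a
facility of `T`, the `k`-th of them pays its distance plus roughly a `1/k` share of the opening cost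
and earlier distances, which sums to a harmonic number (`sum_le_harmonic_mul`). Finally, if every
later phase costs at most `X`, doubling limits all of them together to `3X` (`run_B_le_of_phases`).
-/

/-! ### Shortest-path distances -/

namespace Network

variable {V : Type*} (N : Network V)

theorem walkCost_nonneg : ∀ {u v : V} (p : N.graph.Walk u v), 0 ≤ N.walkCost p
  | _, _, .nil => le_rfl
  | _, _, .cons _ p => add_nonneg (N.cost_nonneg _ _) (walkCost_nonneg p)

theorem walkCost_append : ∀ {u v w : V} (p : N.graph.Walk u v) (q : N.graph.Walk v w),
    N.walkCost (p.append q) = N.walkCost p + N.walkCost q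
  | _, _, _, .nil, q => by simp [walkCost]
  | _, _, _, .cons h p, q => by
    simp [walkCost, walkCost_append p q, add_assoc]

theorem walkCost_reverse : ∀ {u v : V} (p : N.graph.Walk u v),
    N.walkCost p.reverse = N.walkCost p
  | _, _, .nil => rfl
  | _, _, .cons h p => by
    rw [SimpleGraph.Walk.reverse_cons, walkCost_append, walkCost_reverse p]
    simp [walkCost, N.cost_symm, add_comm]

theorem bddBelow_walkCost (u v : V) :
    BddBelow (Set.range fun p : N.graph.Walk u v => N.walkCost p) :=
  ⟨0, by rintro _ ⟨p, rfl⟩; exact N.walkCost_nonneg p⟩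

theorem nonempty_walk (u v : V) : Nonempty (N.graph.Walk u v) := N.connected.preconnected u v

theorem dist_le_walkCost {u v : V} (p : N.graph.Walk u v) : N.dist u v ≤ N.walkCost p :=
  ciInf_le (N.bddBelow_walkCost u v) p

theorem le_dist {u v : V} {a : ℝ} (h : ∀ p : N.graph.Walk u v, a ≤ N.walkCost p) :
    a ≤ N.dist u v :=
  haveI := N.nonempty_walk u v
  le_ciInf h

theorem dist_nonneg (u v : V) : 0 ≤ N.dist u v := N.le_dist N.walkCost_nonneg

theorem dist_self (u : V) : N.dist u u = 0 :=
  le_antisymm (N.dist_le_walkCost .nil) (N.dist_nonneg u u)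

theorem dist_symm (u v : V) : N.dist u v = N.dist v u := by
  have h : ∀ u v : V, N.dist u v ≤ N.dist v u := fun u v => N.le_dist fun p => by
    rw [← N.walkCost_reverse p]
    exact N.dist_le_walkCost _
  exact le_antisymm (h u v) (h v u)

theorem dist_triangle (u v w : V) : N.dist u w ≤ N.dist u v + N.dist v w := by
  have h : N.dist u w - N.dist v w ≤ N.dist u v := N.le_dist fun p => by
    have : N.dist u w - N.walkCost p ≤ N.dist v w := N.le_dist fun q => by
      have := N.dist_le_walkCost (p.append q)
      rw [walkCost_append] at this
      linarith
    linarith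
  linarith

theorem dist_le_cost {u v : V} (h : N.graph.Adj u v) : N.dist u v ≤ N.cost u v := by
  simpa [walkCost] using N.dist_le_walkCost (SimpleGraph.Walk.cons h .nil)

/-- A function that changes by at most the edge cost along every edge gives a lower bound on
distances. -/
theorem sub_le_dist (φ : V → ℝ) (hφ : ∀ x y, N.graph.Adj x y → φ x - φ y ≤ N.cost x y)
    (u v : V) : φ u - φ v ≤ N.dist u v := by
  refine N.le_dist fun p => ?_
  induction p with
  | nil => simp [walkCost]
  | cons h p ih =>
    have := hφ _ _ h
    simp only [walkCost]
    linarith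

theorem distTo_le {F : Finset V} {v : V} (hv : v ∈ F) (r : V) : N.distTo F r ≤ N.dist v r :=
  ciInf_le (Set.finite_range fun v : F => N.dist v r).bddBelow (⟨v, hv⟩ : F)

theorem le_distTo {F : Finset V} (hF : F.Nonempty) {r : V} {a : ℝ}
    (h : ∀ v ∈ F, a ≤ N.dist v r) : a ≤ N.distTo F r :=
  haveI := hF.to_subtype
  le_ciInf fun v => h v v.2

theorem distTo_nonneg (F : Finset V) (r : V) : 0 ≤ N.distTo F r :=
  Real.iInf_nonneg fun _ => N.dist_nonneg _ _

theorem distTo_triangle {F : Finset V} (hF : F.Nonempty) (r s : V) :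
    N.distTo F r ≤ N.distTo F s + N.dist s r := by
  have : N.distTo F r - N.dist s r ≤ N.distTo F s := N.le_distTo hF fun v hv => by
    have := N.distTo_le hv r
    have := N.dist_triangle v s r
    linarith
  linarith

theorem distTo_singleton (w r : V) : N.distTo {w} r = N.dist w r :=
  le_antisymm (N.distTo_le (by simp) r)
    (N.le_distTo (by simp) fun v hv => by rw [Finset.mem_singleton.1 hv])

theorem distTo_insert [DecidableEq V] {F : Finset V} (hF : F.Nonempty) (w r : V) :
    N.distTo (insert w F) r = min (N.distTo F r) (N.dist w r) := by
  apply le_antisymm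
  · refine le_min (N.le_distTo hF fun v hv => N.distTo_le (by simp [hv]) r)
      (N.distTo_le (by simp) r)
  · refine N.le_distTo (by simp) fun v hv => ?_
    rcases Finset.mem_insert.1 hv with rfl | hv
    · exact min_le_right _ _
    · exact (min_le_left _ _).trans (N.distTo_le hv r)

end Network

/-! ### The online component: potentials and amortized costs -/

theorem argMin_spec {W : Type*} [Nonempty W] {s : Finset W} (hs : s.Nonempty) (g : W → ℝ) :
    argMin s g ∈ s ∧ ∀ v ∈ s, g (argMin s g) ≤ g v :=
  Classical.epsilon_spec (p := fun w => w ∈ s ∧ ∀ v ∈ s, g w ≤ g v) (s.exists_min_image g hs)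

namespace OnlineState

variable {W : Type*} {I : UFLInstance W} {f : W → ℝ} {s : OnlineState W}

/-- Invariants of the online algorithm with opening costs `f`. -/
structure Valid (I : UFLInstance W) (f : W → ℝ) (s : OnlineState W) : Prop where
  subset_sites : s.F ⊆ I.sites
  p_eq : s.F.Nonempty → s.p = newPotentials I s.F s.L
  L_eq_nil : s.F = ∅ → s.L = []
  p_eq_zero : s.F = ∅ → s.p = fun _ => 0
  p_le : ∀ v ∈ I.sites, s.p v ≤ f v

/-- The total distance of the requests so far to the open facilities. -/
noncomputable def connection (I : UFLInstance W) (s : OnlineState W) : ℝ :=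
  (s.L.map (I.distTo s.F)).sum

theorem connection_nonneg (s : OnlineState W) : 0 ≤ s.connection I :=
  List.sum_nonneg fun x hx => by
    obtain ⟨q, -, rfl⟩ := List.mem_map.1 hx
    exact I.distTo_nonneg _ _

theorem connection_init : (init W).connection I = 0 := rfl

theorem newPotentials_cons (F : Finset W) (L : List W) (r v : W) :
    newPotentials I F (r :: L) v =
      newPotentials I F L v + max (I.distTo F r - I.dist v r) 0 := by
  simp [newPotentials, add_comm]

theorem newPotentials_nonneg (F : Finset W) (L : List W) (v : W) :
    0 ≤ newPotentials I F L v :=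
  List.sum_nonneg fun x hx => by
    obtain ⟨q, -, rfl⟩ := List.mem_map.1 hx
    exact le_max_right _ _

theorem valid_init (hf : ∀ v ∈ I.sites, 0 ≤ f v) : Valid I f (init W) :=
  ⟨by simp [init], by simp [init], fun _ => rfl, fun _ => rfl, hf⟩

theorem Valid.p_nonneg (h : Valid I f s) (v : W) : 0 ≤ s.p v := by
  rcases s.F.eq_empty_or_nonempty with hF | hF
  · rw [h.p_eq_zero hF]
  · rw [h.p_eq hF]
    exact newPotentials_nonneg _ _ _

open scoped Classical in
theorem newPotentials_insert_le {F : Finset W} (hF : F.Nonempty) (w : W) (L : List W) (v : W) :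
    newPotentials I (insert w F) L v ≤ newPotentials I F L v := by
  refine List.sum_le_sum fun q _ => ?_
  rw [I.distTo_insert hF]
  gcongr
  exact min_le_left _ _

open scoped Classical in
/-- The potential of `w` is the decrease of the total distance when `w` is opened. -/
theorem newPotentials_eq_sub {F : Finset W} (hF : F.Nonempty) (w : W) (L : List W) :
    newPotentials I F L w =
      (L.map (I.distTo F)).sum - (L.map (I.distTo (insert w F))).sum := by
  induction L with
  | nil => simp [newPotentials]
  | cons r L ih =>
    rw [newPotentials_cons, ih, List.map_cons, List.map_cons, List.sum_cons, List.sum_cons,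
      I.distTo_insert hF]
    rcases le_total (I.distTo F r) (I.dist w r) with h | h
    · rw [min_eq_left h, max_eq_right (by linarith)]; ring
    · rw [min_eq_right h, max_eq_left (by linarith)]; ring

open scoped Classical in
/-- The ways in which a step of the online algorithm can proceed. -/
theorem step_cases (I : UFLInstance W) (f : W → ℝ) (s : OnlineState W) (r : W)
    {P : OnlineState W → Prop}
    (first : ∀ w ∈ I.sites, s.F = ∅ → (∀ v ∈ I.sites, f w + I.dist w r ≤ f v + I.dist v r) →
      P ⟨{w}, r :: s.L, newPotentials I {w} (r :: s.L)⟩)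
    (opens : ∀ w ∈ I.sites, s.F.Nonempty →
      f w < s.p w + max (I.distTo s.F r - I.dist w r) 0 →
      (∀ v ∈ I.sites, s.p v + max (I.distTo s.F r - I.dist v r) 0 - f v ≤
        s.p w + max (I.distTo s.F r - I.dist w r) 0 - f w) →
      P ⟨insert w s.F, r :: s.L, newPotentials I (insert w s.F) (r :: s.L)⟩)
    (stays : s.F.Nonempty →
      (∀ v ∈ I.sites, s.p v + max (I.distTo s.F r - I.dist v r) 0 ≤ f v) →
      P ⟨s.F, r :: s.L, fun v => s.p v + max (I.distTo s.F r - I.dist v r) 0⟩) :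
    P (s.step I f r) := by
  have : Nonempty W := I.connected.nonempty
  unfold step
  dsimp only
  split_ifs with hF hw
  · obtain ⟨h1, h2⟩ := argMin_spec I.sites_nonempty fun v => f v + I.dist v r
    exact first _ h1 hF h2
  · obtain ⟨h1, h2⟩ := argMin_spec I.sites_nonempty
      fun v => -(s.p v + max (I.distTo s.F r - I.dist v r) 0 - f v)
    exact opens _ h1 (Finset.nonempty_iff_ne_empty.2 hF) hw fun v hv => neg_le_neg_iff.1 (h2 v hv)
  · obtain ⟨h1, h2⟩ := argMin_spec I.sites_nonempty
      fun v => -(s.p v + max (I.distTo s.F r - I.dist v r) 0 - f v)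
    refine stays (Finset.nonempty_iff_ne_empty.2 hF) fun v hv => ?_
    have := h2 v hv
    rw [not_lt] at hw
    linarith

theorem step_L (r : W) : (s.step I f r).L = r :: s.L :=
  step_cases I f s r (P := fun s' => s'.L = r :: s.L) (fun _ _ _ _ => rfl)
    (fun _ _ _ _ _ => rfl) fun _ _ => rfl

theorem step_F_nonempty (r : W) : (s.step I f r).F.Nonempty := by
  classical
  exact step_cases I f s r (P := fun s' => s'.F.Nonempty) (fun _ _ _ _ => by simp)
    (fun _ _ _ _ _ => by simp) fun h _ => h

/-- The substance is `p ≤ f`. When `w` opens, old requests contribute no more to `v` than before,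
and `r` contributes `(d(w, r) - d(v, r))_+`. If this is positive, maximality of `w` gives `p v - f v
+ d(w, r) - d(v, r) ≤ p w - f w ≤ 0` for the old potentials. -/
theorem Valid.step (h : Valid I f s) (hf : ∀ v ∈ I.sites, 0 ≤ f v) (r : W) :
    Valid I f (s.step I f r) := by
  classical
  refine step_cases I f s r ?_ ?_ ?_
  · intro w hw hF hmin
    refine ⟨by simpa, fun _ => rfl, by simp, by simp, fun v hv => ?_⟩
    simp only [newPotentials, h.L_eq_nil hF, List.map_cons, List.map_nil, List.sum_cons,
      List.sum_nil, add_zero, I.distTo_singleton]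
    have := hmin v hv
    have := hf w hw
    exact max_le (by linarith) (hf v hv)
  · intro w hw hF hlt hmax
    refine ⟨Finset.insert_subset hw h.subset_sites, fun _ => rfl, by simp, by simp,
      fun v hv => ?_⟩
    have hpw := h.p_le w hw
    have hpv := h.p_le v hv
    have hm := hmax v hv
    dsimp only
    rw [newPotentials_cons, I.distTo_insert hF]
    have hle := newPotentials_insert_le (I := I) hF w s.L v
    rw [← h.p_eq hF] at hle
    -- Before `r` the potential of `w` was at most `f w`, so only a positive contribution of `r` can
    -- have pushed it above.
    have hwr : I.dist w r < I.distTo s.F r := by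
      by_contra! hc
      rw [max_eq_right (by linarith)] at hlt
      linarith
    rw [min_eq_right hwr.le]
    rcases le_total (I.dist w r) (I.dist v r) with hc | hc
    · rw [max_eq_right (by linarith)]
      linarith
    · rw [max_eq_left (by linarith)] at hm ⊢
      rw [max_eq_left (by linarith)] at hm
      linarith
  · intro hF hle
    refine ⟨h.subset_sites, fun _ => ?_, fun h' => absurd h' hF.ne_empty,
      fun h' => absurd h' hF.ne_empty, hle⟩
    funext v
    dsimp only
    rw [newPotentials_cons, h.p_eq hF]

/-- The smallest `f v - p v + d(v, r)`. -/
noncomputable def openingBound (I : UFLInstance W) (f : W → ℝ) (s : OnlineState W) (r : W) : ℝ :=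
  ⨅ v : I.sites, (f v - s.p v + I.dist v r)

theorem openingBound_le {v : W} (hv : v ∈ I.sites) (r : W) :
    s.openingBound I f r ≤ f v - s.p v + I.dist v r :=
  ciInf_le (Set.finite_range fun v : I.sites => f v - s.p v + I.dist v r).bddBelow
    (⟨v, hv⟩ : I.sites)

theorem le_openingBound {a : ℝ} {r : W} (h : ∀ v ∈ I.sites, a ≤ f v - s.p v + I.dist v r) :
    a ≤ s.openingBound I f r :=
  haveI := I.sites_nonempty.to_subtype
  le_ciInf fun v => h v v.2

theorem amortizedCost_of_empty (h : s.F = ∅) (r : W) :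
    s.amortizedCost I f r = 2 * s.openingBound I f r := by
  simp [amortizedCost, h, openingBound]

theorem amortizedCost_of_nonempty (h : s.F.Nonempty) (r : W) :
    s.amortizedCost I f r = 2 * min (I.distTo s.F r) (s.openingBound I f r) := by
  simp [amortizedCost, h.ne_empty, openingBound]

theorem amortizedCost_le {v : W} (hv : v ∈ I.sites) (r : W) :
    s.amortizedCost I f r ≤ 2 * (f v - s.p v + I.dist v r) := by
  have := openingBound_le (f := f) (s := s) hv r
  rcases s.F.eq_empty_or_nonempty with hF | hF
  · rw [amortizedCost_of_empty hF]
    linarith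
  · rw [amortizedCost_of_nonempty hF]
    have := min_le_right (I.distTo s.F r) (s.openingBound I f r)
    linarith

theorem Valid.amortizedCost_nonneg (h : Valid I f s) (r : W) : 0 ≤ s.amortizedCost I f r := by
  have ha : 0 ≤ s.openingBound I f r := le_openingBound fun v hv => by
    have := h.p_le v hv
    have := I.dist_nonneg v r
    linarith
  rcases s.F.eq_empty_or_nonempty with hF | hF
  · rw [amortizedCost_of_empty hF]
    linarith
  · rw [amortizedCost_of_nonempty hF]
    have := le_min (I.distTo_nonneg s.F r) ha
    linarith

open scoped Classical in
/-- The amortized cost of a request pays for the facility opened, for the connection of the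
request, and for the change of the total distance. -/
theorem Valid.step_cost_le (h : Valid I f s) (hf : ∀ v ∈ I.sites, 0 ≤ f v) (r : W) :
    ∑ v ∈ (s.step I f r).F \ s.F, f v + I.distTo (s.step I f r).F r +
      (s.step I f r).connection I ≤ s.amortizedCost I f r + s.connection I := by
  refine step_cases I f s r (P := fun s' => ∑ v ∈ s'.F \ s.F, f v + I.distTo s'.F r +
    s'.connection I ≤ s.amortizedCost I f r + s.connection I) ?_ ?_ ?_
  · intro w hw hF hmin
    have hb : f w + I.dist w r ≤ s.openingBound I f r := le_openingBound fun v hv => by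
      simpa [h.p_eq_zero hF] using hmin v hv
    have := hf w hw
    rw [amortizedCost_of_empty hF]
    simp only [connection, hF, Finset.sdiff_empty, Finset.sum_singleton, I.distTo_singleton,
      h.L_eq_nil hF, List.map_cons, List.map_nil, List.sum_cons, List.sum_nil]
    linarith
  · intro w hw hF hlt hmax
    have hpw := h.p_le w hw
    have hwr : I.dist w r < I.distTo s.F r := by
      by_contra! hc
      rw [max_eq_right (by linarith)] at hlt
      linarith
    rw [max_eq_left (by linarith)] at hlt hmax
    have hb : f w - s.p w + I.dist w r ≤ s.openingBound I f r := le_openingBound fun v hv => by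
      have := hmax v hv
      have := le_max_left (I.distTo s.F r - I.dist v r) 0
      linarith
    have hsum : ∑ v ∈ insert w s.F \ s.F, f v ≤ f w := by
      calc ∑ v ∈ insert w s.F \ s.F, f v ≤ ∑ v ∈ {w}, f v := by
            refine Finset.sum_le_sum_of_subset_of_nonneg ?_ ?_
            · intro x hx
              simp only [Finset.mem_sdiff, Finset.mem_insert] at hx
              rw [Finset.mem_singleton]
              tauto
            · intro x hx _
              rw [Finset.mem_singleton.1 hx]
              exact hf w hw
        _ = f w := by simp
    -- The old requests get closer by `p w` in total, so the net price of `w` is `f w - p w ≥ 0`.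
    -- The factor 2 in the amortized cost covers `d(w, r)` twice: as connection cost and as the new
    -- term of the total distance.
    have hpot := newPotentials_eq_sub (I := I) hF w s.L
    rw [← h.p_eq hF] at hpot
    rw [amortizedCost_of_nonempty hF]
    have hmn : f w - s.p w + I.dist w r ≤ min (I.distTo s.F r) (s.openingBound I f r) :=
      le_min (by linarith) hb
    simp only [connection, List.map_cons, List.sum_cons, I.distTo_insert hF]
    rw [min_eq_right hwr.le]
    linarith
  · intro hF hle
    have hb : I.distTo s.F r ≤ s.openingBound I f r := le_openingBound fun v hv => by
      have := hle v hv
      have := le_max_left (I.distTo s.F r - I.dist v r) 0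
      linarith
    rw [amortizedCost_of_nonempty hF, min_eq_left hb]
    simp only [connection, sdiff_self, Finset.bot_eq_empty, Finset.sum_empty, List.map_cons,
      List.sum_cons]
    linarith

/-- A lower bound on potentials from the requests of a sublist. -/
theorem Valid.card_mul_le (h : Valid I f s) (hF : s.F.Nonempty) {ι : Type*} {A : Finset ι}
    {q : ι → W} (v : W)
    (hA : ∑ j ∈ A, max (I.distTo s.F (q j) - I.dist v (q j)) 0 ≤ newPotentials I s.F s.L v) :
    A.card * I.distTo s.F v ≤ s.p v + 2 * ∑ j ∈ A, I.dist v (q j) := by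
  rw [← h.p_eq hF] at hA
  have : ∑ j ∈ A, (I.distTo s.F v - 2 * I.dist v (q j)) ≤ s.p v := by
    refine le_trans (Finset.sum_le_sum fun j _ => ?_) hA
    -- `d(F, v) ≤ d(F, q) + d(q, v)`, so a request near `v` and far from `F` contributes at least
    -- `d(F, v) - 2 d(v, q)`.
    have := I.distTo_triangle hF v (q j)
    rw [I.dist_symm (q j) v] at this
    exact le_trans (by linarith) (le_max_left _ _)
  rw [Finset.sum_sub_distrib, Finset.sum_const, nsmul_eq_mul, ← Finset.mul_sum] at this
  linarith

/-- The amortized cost of a request, compared with a facility `v` and the requests in `A`, which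
arrived earlier. -/
theorem Valid.amortizedCost_le_div (h : Valid I f s) {ι : Type*} {A : Finset ι} {q : ι → W}
    {v : W} (hv : v ∈ I.sites) (r : W)
    (hA : ∀ g : W → ℝ, (∀ x, 0 ≤ g x) → ∑ j ∈ A, g (q j) ≤ (s.L.map g).sum) :
    s.amortizedCost I f r ≤
      2 * (I.dist v r + (f v + 2 * ∑ j ∈ A, I.dist v (q j)) / (A.card + 1)) := by
  have hop := openingBound_le (f := f) (s := s) hv r
  have hk : (0 : ℝ) < A.card + 1 := by positivity
  rcases s.F.eq_empty_or_nonempty with hF | hF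
  · have hc : A = ∅ := by
      have := hA (fun _ => 1) fun _ => zero_le_one
      simp [h.L_eq_nil hF] at this
      exact this
    rw [amortizedCost_of_empty hF]
    rw [h.p_eq_zero hF] at hop
    simp only [hc, Finset.sum_empty, Finset.card_empty]
    norm_num
    linarith
  · have h1 := h.card_mul_le hF v (hA (fun x => max (I.distTo s.F x - I.dist v x) 0)
      fun _ => le_max_right _ _)
    rw [amortizedCost_of_nonempty hF]
    set a := min (I.distTo s.F r) (s.openingBound I f r) with ha
    have ha1 : a ≤ I.distTo s.F v + I.dist v r :=
      (min_le_left _ _).trans (I.distTo_triangle hF r v)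
    have ha2 : a ≤ f v - s.p v + I.dist v r := (min_le_right _ _).trans hop
    have hc : (0 : ℝ) ≤ A.card := Nat.cast_nonneg _
    -- Add `A.card` copies of `ha1` to `ha2`: by `h1` the term `A.card * d(F, v)` is absorbed by `p
    -- v`, up to twice the distances from `v` to `A`.
    have h2 := mul_le_mul_of_nonneg_left ha1 hc
    have h3 : a - I.dist v r ≤ (f v + 2 * ∑ j ∈ A, I.dist v (q j)) / (A.card + 1) := by
      rw [le_div_iff₀ hk]
      linarith
    linarith

end OnlineState

/-! ### Summing shares of the opening cost -/

theorem harmonic_mono : Monotone harmonic := monotone_nat_of_le_succ fun n => by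
  rw [harmonic_succ]
  have : (0 : ℚ) ≤ (↑(n + 1))⁻¹ := by positivity
  linarith

theorem sum_le_harmonic_mul {A : Finset ℕ} {a d : ℕ → ℝ} {f : ℝ} (hf : 0 ≤ f)
    (hd : ∀ i, 0 ≤ d i)
    (h : ∀ i ∈ A, a i ≤ d i + (f + 2 * ∑ j ∈ A with j < i, d j) / ({j ∈ A | j < i}.card + 1)) :
    ∑ i ∈ A, a i ≤ (1 + 2 * harmonic A.card) * (f + ∑ i ∈ A, d i) := by
  -- The induction adds the latest request. A fixed `D` that bounds the distance sums of all subsets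
  -- survives it; each new element then contributes its distance and `(f + 2 * D) / k`, where `k` is
  -- its rank.
  have key : ∀ {D : ℝ}, (∀ B ⊆ A, ∑ i ∈ B, d i ≤ D) →
      ∑ i ∈ A, a i ≤ ∑ i ∈ A, d i + (f + 2 * D) * harmonic A.card := by
    intro D
    induction A using Finset.induction_on_max with
    | empty => simp
    | insert x A hx ih =>
      intro hD
      have hxA : x ∉ A := fun hc => lt_irrefl _ (hx x hc)
      rw [Finset.sum_insert hxA, Finset.sum_insert hxA, Finset.card_insert_of_notMem hxA,
        harmonic_succ]
      have e1 : {j ∈ insert x A | j < x} = A := by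
        ext j
        simp only [Finset.mem_filter, Finset.mem_insert]
        constructor
        · rintro ⟨rfl | h, h'⟩
          · exact absurd h' (lt_irrefl _)
          · exact h
        · exact fun h => ⟨Or.inr h, hx j h⟩
      have e2 : ∀ i ∈ A, {j ∈ insert x A | j < i} = {j ∈ A | j < i} := by
        intro i hi
        rw [Finset.filter_insert, if_neg (not_lt.2 (hx i hi).le)]
      have h1 := h x (by simp)
      rw [e1] at h1
      have h2 := ih (fun i hi => by simpa [e2 i hi] using h i (by simp [hi]))
        fun B hB => hD B (hB.trans (Finset.subset_insert _ _))
      have h3 := hD A (Finset.subset_insert _ _)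
      have h4 : (f + 2 * ∑ j ∈ A, d j) / (A.card + 1) ≤ (f + 2 * D) * (↑(A.card + 1))⁻¹ := by
        rw [div_eq_mul_inv]
        push_cast
        gcongr
      push_cast at h4 ⊢
      rw [mul_add]
      linarith
  have h1 := key (D := ∑ i ∈ A, d i) fun B hB =>
    Finset.sum_le_sum_of_subset_of_nonneg hB fun i _ _ => hd i
  have h2 : (0 : ℝ) ≤ harmonic A.card := by
    exact_mod_cast (harmonic_zero ▸ harmonic_mono (Nat.zero_le A.card) : (0 : ℚ) ≤ _)
  nlinarith [mul_nonneg hf h2]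

/-! ### Prize-collecting solutions -/

namespace PCSolution

variable {W : Type*} {I : UFLInstance W} {m : ℕ} {Q : Fin m → W}

theorem connection_term_nonneg (T : PCSolution I m) (j : Fin m) :
    0 ≤ ((T.assign j).map fun v => I.dist (Q j) v).getD 0 := by
  cases T.assign j with
  | none => simp
  | some v => simpa using I.dist_nonneg _ _

theorem sum_openCost_le_cost (T : PCSolution I m) :
    ∑ v ∈ T.opened, I.openCost v ≤ T.cost Q :=
  le_add_of_nonneg_right (Finset.sum_nonneg fun j _ => T.connection_term_nonneg j)

theorem sum_connection_le_cost (T : PCSolution I m) :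
    ∑ j, ((T.assign j).map fun v => I.dist (Q j) v).getD 0 ≤ T.cost Q :=
  le_add_of_nonneg_left (Finset.sum_nonneg fun v _ => (I.openCost_pos v).le)

theorem cost_nonneg (T : PCSolution I m) : 0 ≤ T.cost Q :=
  (Finset.sum_nonneg fun v _ => (I.openCost_pos v).le).trans T.sum_openCost_le_cost

theorem mem_unsatisfied {T : PCSolution I m} {j : Fin m} :
    j ∈ T.unsatisfied ↔ T.assign j = none := by
  simp [unsatisfied]

theorem value_const (T : PCSolution I m) (x : ℝ) :
    T.value Q (fun _ => x) = T.cost Q + T.unsatisfied.card * x := by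
  simp [value]

theorem cost_empty : (empty I m).cost Q = 0 := by
  simp [cost, empty]

theorem card_unsatisfied_empty : (empty I m).unsatisfied.card = m := by
  simp [unsatisfied, empty]

theorem card_unsatisfied_of_opened_eq_empty {T : PCSolution I m} (h : T.opened = ∅) :
    T.unsatisfied.card = m := by
  have : T.unsatisfied = Finset.univ := by
    ext j
    simp only [mem_unsatisfied, Finset.mem_univ, iff_true]
    cases hj : T.assign j with
    | none => rfl
    | some v => simpa [h] using T.assign_mem j v hj
  simp [this]

theorem exists_unsatisfied_eq_empty (I : UFLInstance W) (m : ℕ) :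
    ∃ T : PCSolution I m, T.unsatisfied = ∅ := by
  obtain ⟨w, hw⟩ := I.sites_nonempty
  refine ⟨⟨{w}, by simpa, fun _ => some w, by simp⟩, ?_⟩
  simp [unsatisfied]

end PCSolution

/-! ### The subroutine `Partial` -/

section Partial

variable {W : Type*} {I : UFLInstance W} {PC : PCAlgorithm I} {γ : ℝ} {m : ℕ}
  {Rhat : Fin m → W} {u : ℕ}

/-- The number of requests left unsatisfied when all penalties are `2 ^ i`. -/
noncomputable def unsatisfiedCount (PC : PCAlgorithm I) (Rhat : Fin m → W) (i : ℤ) : ℕ :=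
  (PC m Rhat fun _ => (2 : ℝ) ^ i).unsatisfied.card

theorem PCAlgorithm.IsApprox.const_le (h : PC.IsApprox γ) (Rhat : Fin m → W)
    (T : PCSolution I m) (i : ℤ) :
    (PC m Rhat fun _ => (2 : ℝ) ^ i).cost Rhat + unsatisfiedCount PC Rhat i * (2 : ℝ) ^ i ≤
      γ * (T.cost Rhat + T.unsatisfied.card * (2 : ℝ) ^ i) := by
  have := h m Rhat (fun _ => (2 : ℝ) ^ i) (fun _ => by positivity) T
  rwa [PCSolution.value_const, PCSolution.value_const] at this

/-- Once `2 ^ k` exceeds `γ` times the cost of a solution that satisfies everything, even one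
penalty is too expensive. -/
theorem exists_unsatisfiedCount_eq_zero (h : PC.IsApprox γ) (Rhat : Fin m → W) :
    ∃ i : ℤ, unsatisfiedCount PC Rhat i = 0 := by
  obtain ⟨T, hT⟩ := PCSolution.exists_unsatisfied_eq_empty I m
  obtain ⟨k, hk⟩ := pow_unbounded_of_one_lt (γ * T.cost Rhat) (one_lt_two : (1 : ℝ) < 2)
  refine ⟨k, ?_⟩
  have h1 := h.const_le Rhat T k
  have h2 := (PC m Rhat fun _ => (2 : ℝ) ^ (k : ℤ)).cost_nonneg (Q := Rhat)
  rw [hT] at h1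
  simp only [zpow_natCast, Finset.card_empty, Nat.cast_zero, zero_mul, add_zero] at h1 h2
  by_contra hc
  have h3 : (1 : ℝ) ≤ unsatisfiedCount PC Rhat k := by
    exact_mod_cast Nat.one_le_iff_ne_zero.2 hc
  have h4 : (0 : ℝ) < 2 ^ k := by positivity
  nlinarith

/-- The empty solution has value `m * 2 ^ i`. When `γ` times this is below the cheapest opening
cost, the approximation cannot open anything. -/
theorem exists_forall_unsatisfiedCount_eq (h : PC.IsApprox γ) (Rhat : Fin m → W) :
    ∃ k : ℤ, ∀ i ≤ k, unsatisfiedCount PC Rhat i = m := by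
  obtain ⟨w, -, hmin⟩ := I.sites.exists_min_image I.openCost I.sites_nonempty
  have hw := I.openCost_pos w
  obtain ⟨k, hk⟩ := pow_unbounded_of_one_lt (γ * m / I.openCost w) (one_lt_two : (1 : ℝ) < 2)
  refine ⟨-k, fun i hi => PCSolution.card_unsatisfied_of_opened_eq_empty ?_⟩
  by_contra hne
  obtain ⟨v, hv⟩ := Finset.nonempty_iff_ne_empty.2 hne
  set S := PC m Rhat fun _ => (2 : ℝ) ^ i
  have h1 := h.const_le Rhat (PCSolution.empty I m) i
  rw [PCSolution.cost_empty, PCSolution.card_unsatisfied_empty, zero_add] at h1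
  have h2 : I.openCost v ≤ S.cost Rhat :=
    (Finset.single_le_sum (fun x _ => (I.openCost_pos x).le) hv).trans S.sum_openCost_le_cost
  have h3 := hmin v (S.opened_subset hv)
  have h4 : (0 : ℝ) ≤ unsatisfiedCount PC Rhat i * (2 : ℝ) ^ i := by positivity
  have h5 : (2 : ℝ) ^ i ≤ (2 ^ k)⁻¹ := by
    rw [← zpow_natCast, ← zpow_neg]
    exact zpow_le_zpow_right₀ one_le_two hi
  have h6 : (0 : ℝ) < 2 ^ k := by positivity
  rw [div_lt_iff₀ hw] at hk
  have h7 : I.openCost w ≤ γ * m * (2 : ℝ) ^ i := by linarith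
  have h8 : (0 : ℝ) < 2 ^ i := by positivity
  have h9 : 0 < γ * m := by
    by_contra! hc
    nlinarith
  have h10 : γ * m * (2 : ℝ) ^ i ≤ γ * m * (2 ^ k)⁻¹ := by gcongr
  have h11 : γ * m * (2 ^ k)⁻¹ < I.openCost w := by
    rw [← div_eq_mul_inv, div_lt_iff₀ h6]
    linarith
  linarith

/-- `Partial(Rhat, u)` costs at most `3γ` times as much as any solution that leaves at most `u`
requests unsatisfied, and leaves at most `2γu` requests unsatisfied. -/
theorem partialSol_spec (hγ : 1 ≤ γ) (h : PC.IsApprox γ) (Rhat : Fin m → W) (u : ℕ) :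
    ((partialSol PC γ Rhat u).unsatisfied.card : ℝ) ≤ 2 * γ * u ∧
      ∀ T : PCSolution I m, T.unsatisfied.card ≤ u →
        (partialSol PC γ Rhat u).cost Rhat ≤ 3 * γ * T.cost Rhat := by
  have hu : 0 ≤ γ * u := by positivity
  unfold partialSol
  split_ifs with hm
  · refine ⟨?_, fun T _ => ?_⟩
    · rw [PCSolution.card_unsatisfied_empty]
      linarith
    · have := T.cost_nonneg (Q := Rhat)
      rw [PCSolution.cost_empty]
      positivity
  dsimp only
  set s : Set ℤ := {i : ℤ | ((PC m Rhat fun _ => (2 : ℝ) ^ i).unsatisfied.card : ℝ) ≤ γ * u}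
  -- An infimum in `ℤ` is an attained minimum only for sets that are nonempty and bounded below; the
  -- bound uses `γ * u < m`.
  have hne : s.Nonempty := by
    obtain ⟨i, hi⟩ := exists_unsatisfiedCount_eq_zero h Rhat
    refine ⟨i, ?_⟩
    change (unsatisfiedCount PC Rhat i : ℝ) ≤ γ * u
    simpa [hi] using hu
  have hbdd : BddBelow s := by
    obtain ⟨k, hk⟩ := exists_forall_unsatisfiedCount_eq h Rhat
    refine ⟨k, fun i hi => ?_⟩
    by_contra! hik
    change (unsatisfiedCount PC Rhat i : ℝ) ≤ γ * u at hi
    rw [hk i hik.le] at hi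
    exact hm hi
  set i := sInf s
  have hi : (unsatisfiedCount PC Rhat i : ℝ) ≤ γ * u := Int.csInf_mem hne hbdd
  have hi' : γ * u < unsatisfiedCount PC Rhat (i - 1) := by
    by_contra! hc
    have : i ≤ i - 1 := csInf_le hbdd hc
    omega
  have h2 : (2 : ℝ) ^ i = 2 * 2 ^ (i - 1) := by
    rw [zpow_sub_one₀ two_ne_zero]
    ring
  have hpos : (0 : ℝ) < 2 ^ (i - 1) := by positivity
  -- The approximation guarantee for both penalties, with the penalty terms collected: the cheaper
  -- penalty leaves an excess over `γ * u`, the dearer one a deficit.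
  have main : ∀ T : PCSolution I m, T.unsatisfied.card ≤ u →
      (PC m Rhat fun _ => (2 : ℝ) ^ (i - 1)).cost Rhat +
        2 ^ (i - 1) * (unsatisfiedCount PC Rhat (i - 1) - γ * u) ≤ γ * T.cost Rhat ∧
      (PC m Rhat fun _ => (2 : ℝ) ^ i).cost Rhat ≤
        γ * T.cost Rhat + 2 * 2 ^ (i - 1) * (γ * u - unsatisfiedCount PC Rhat i) := by
    intro T hT
    have hT' : (T.unsatisfied.card : ℝ) ≤ u := by exact_mod_cast hT
    have ha := h.const_le Rhat T (i - 1)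
    have hb := h.const_le Rhat T i
    have hc : γ * (T.unsatisfied.card * 2 ^ (i - 1)) ≤ γ * (u * 2 ^ (i - 1)) := by gcongr
    have hd : γ * (T.unsatisfied.card * 2 ^ i) ≤ γ * (u * 2 ^ i) := by gcongr
    rw [← h2]
    constructor <;> linarith
  split_ifs with havg <;>
    [change ((unsatisfiedCount PC Rhat (i - 1) : ℝ) + unsatisfiedCount PC Rhat i) / 2 ≤ γ * u
      at havg;
     change ¬ ((unsatisfiedCount PC Rhat (i - 1) : ℝ) + unsatisfiedCount PC Rhat i) / 2 ≤ γ * u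
      at havg]
  · refine ⟨?_, fun T hT => ?_⟩
    · change (unsatisfiedCount PC Rhat (i - 1) : ℝ) ≤ 2 * γ * u
      have : (0 : ℝ) ≤ unsatisfiedCount PC Rhat i := Nat.cast_nonneg _
      linarith
    · have h3 := (main T hT).1
      have h4 := mul_nonneg hpos.le (sub_nonneg.2 hi'.le)
      have h5 := mul_nonneg (zero_le_one.trans hγ) (T.cost_nonneg (Q := Rhat))
      linarith
  · refine ⟨?_, fun T hT => ?_⟩
    · change (unsatisfiedCount PC Rhat i : ℝ) ≤ 2 * γ * u
      linarith
    · obtain ⟨h3, h4⟩ := main T hT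
      have h5 := (PC m Rhat fun _ => (2 : ℝ) ^ (i - 1)).cost_nonneg (Q := Rhat)
      -- As the average exceeds `γ * u`, the deficit of `S₂` is less than the excess of `S₁`, and
      -- the latter times `2 ^ (i - 1)` is at most `γ * T.cost`. The penalty of `S₂` is twice as
      -- large, which gives `1 + 2 = 3`.
      have h6 : 2 ^ (i - 1) * (γ * u - unsatisfiedCount PC Rhat i) ≤
          2 ^ (i - 1) * (unsatisfiedCount PC Rhat (i - 1) - γ * u) :=
        mul_le_mul_of_nonneg_left (by linarith) hpos.le
      linarith

theorem leastU_spec (hγ : 1 ≤ γ) (PC : PCAlgorithm I) (Rhat : Fin m → W) {b : ℝ} (hb : 0 ≤ b) :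
    (partialSol PC γ Rhat (leastU PC γ Rhat b)).cost Rhat ≤ 3 * γ * b := by
  have hne : {u : ℕ | u ≤ m ∧ (partialSol PC γ Rhat u).cost Rhat ≤ 3 * γ * b}.Nonempty := by
    refine ⟨m, le_rfl, ?_⟩
    have : (m : ℝ) ≤ γ * m := le_mul_of_one_le_left (Nat.cast_nonneg m) hγ
    rw [partialSol, if_pos this, PCSolution.cost_empty]
    positivity
  exact (Nat.sInf_mem hne).2

/-- By `partialSol_spec`, the number of requests that `T` leaves unsatisfied is a candidate in the
definition of `leastU`. -/
theorem card_unsatisfied_leastU_le (hγ : 1 ≤ γ) (h : PC.IsApprox γ) {b : ℝ}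
    {T : PCSolution I m} (hT : T.cost Rhat ≤ b) :
    ((partialSol PC γ Rhat (leastU PC γ Rhat b)).unsatisfied.card : ℝ) ≤
      2 * γ * T.unsatisfied.card := by
  have hle : leastU PC γ Rhat b ≤ T.unsatisfied.card := by
    refine Nat.sInf_le ⟨?_, ?_⟩
    · exact (Finset.card_le_univ _).trans_eq (Fintype.card_fin m)
    · refine ((partialSol_spec hγ h Rhat _).2 T le_rfl).trans ?_
      gcongr
  have : (leastU PC γ Rhat b : ℝ) ≤ T.unsatisfied.card := by exact_mod_cast hle
  refine (partialSol_spec hγ h Rhat _).1.trans ?_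
  gcongr

end Partial

/-! ### One iteration of the framework -/

namespace FrameworkState

variable {W : Type*} {I : UFLInstance W} {PC : PCAlgorithm I} {γ : ℝ} {m : ℕ} {Rhat : Fin m → W}
  {s : FrameworkState W}

theorem currentCost_nonneg (s : FrameworkState W) (v : W) : 0 ≤ s.currentCost I v := by
  unfold currentCost
  split_ifs
  exacts [le_rfl, (I.openCost_pos v).le]

theorem currentCost_le (s : FrameworkState W) (v : W) : s.currentCost I v ≤ I.openCost v := by
  unfold currentCost
  split_ifs
  exacts [(I.openCost_pos v).le, le_rfl]

theorem currentCost_of_mem {v : W} (hv : v ∈ s.Z) : s.currentCost I v = 0 := if_pos hv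

theorem currentCost_of_notMem {v : W} (hv : v ∉ s.Z) : s.currentCost I v = I.openCost v :=
  if_neg hv

/-- The amortized cost of the request `r` that arrives in state `s`. -/
noncomputable def stepCost (I : UFLInstance W) (s : FrameworkState W) (r : W) : ℝ :=
  s.on.amortizedCost I (s.currentCost I) r

/-- Invariants of the framework. -/
structure Valid (I : UFLInstance W) (s : FrameworkState W) : Prop where
  Z_subset : s.Z ⊆ s.S
  S_subset : s.S ⊆ I.sites
  F_subset : s.on.F ⊆ s.S
  on_valid : s.on.Valid I (s.currentCost I)
  Bhat_nonneg : 0 ≤ s.Bhat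
  Bhat_le : s.Bhat ≤ s.B

theorem valid_init (I : UFLInstance W) : (init W).Valid I where
  Z_subset := Finset.Subset.refl _
  S_subset := Finset.empty_subset _
  F_subset := Finset.Subset.refl _
  on_valid := OnlineState.valid_init fun _ _ => currentCost_nonneg _ _
  Bhat_nonneg := le_rfl
  Bhat_le := le_rfl

open scoped Classical in
theorem step_of_le {r : W} (h : 2 * s.Bhat ≤ s.B + s.stepCost I r) :
    s.step I PC γ Rhat r =
      ⟨s.B + s.stepCost I r, s.B + s.stepCost I r,
        s.openAfter I r ∪ (partialSol PC γ Rhat (leastU PC γ Rhat (s.B + s.stepCost I r))).opened,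
        s.openAfter I r ∪ (partialSol PC γ Rhat (leastU PC γ Rhat (s.B + s.stepCost I r))).opened,
        OnlineState.init W⟩ :=
  if_pos h

theorem step_of_lt {r : W} (h : s.B + s.stepCost I r < 2 * s.Bhat) :
    s.step I PC γ Rhat r =
      ⟨s.B + s.stepCost I r, s.Bhat, s.openAfter I r, s.Z, s.onAfter I r⟩ :=
  if_neg (not_le.2 h)

theorem step_B (r : W) : (s.step I PC γ Rhat r).B = s.B + s.stepCost I r := by
  rcases le_or_gt (2 * s.Bhat) (s.B + s.stepCost I r) with h | h
  · rw [step_of_le h]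
  · rw [step_of_lt h]

theorem subset_openAfter (s : FrameworkState W) (r : W) : s.S ⊆ s.openAfter I r := by
  classical
  exact Finset.subset_union_left

theorem onAfter_subset_openAfter (s : FrameworkState W) (r : W) :
    (s.onAfter I r).F ⊆ s.openAfter I r := by
  classical
  exact Finset.subset_union_right

theorem openAfter_subset_step (r : W) : s.openAfter I r ⊆ (s.step I PC γ Rhat r).S := by
  classical
  rcases le_or_gt (2 * s.Bhat) (s.B + s.stepCost I r) with h | h
  · rw [step_of_le h]
    exact Finset.subset_union_left
  · rw [step_of_lt h]

theorem Valid.stepCost_nonneg (h : s.Valid I) (r : W) : 0 ≤ s.stepCost I r :=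
  h.on_valid.amortizedCost_nonneg r

theorem Valid.stepCost_le (h : s.Valid I) {v : W} (hv : v ∈ I.sites) (r : W) :
    s.stepCost I r ≤ 2 * (s.currentCost I v + I.dist v r) := by
  have h1 := OnlineState.amortizedCost_le (f := s.currentCost I) (s := s.on) hv r
  have h2 := h.on_valid.p_nonneg v
  unfold stepCost
  linarith

theorem Valid.onAfter (h : s.Valid I) (r : W) :
    (s.onAfter I r).Valid I (s.currentCost I) :=
  h.on_valid.step (fun _ _ => currentCost_nonneg _ _) r

theorem Valid.openAfter_subset (h : s.Valid I) (r : W) : s.openAfter I r ⊆ I.sites := by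
  classical
  exact Finset.union_subset h.S_subset (h.onAfter r).subset_sites

theorem openAfter_nonempty (s : FrameworkState W) (r : W) : (s.openAfter I r).Nonempty :=
  (OnlineState.step_F_nonempty r).mono (s.onAfter_subset_openAfter r)

theorem target_mem (s : FrameworkState W) (r : W) : s.target I r ∈ s.openAfter I r :=
  haveI : Nonempty W := I.connected.nonempty
  (argMin_spec (s.openAfter_nonempty r) _).1

theorem dist_target_le {v : W} (r : W) (hv : v ∈ s.openAfter I r) :
    I.dist (s.target I r) r ≤ I.dist v r :=
  haveI : Nonempty W := I.connected.nonempty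
  (argMin_spec (s.openAfter_nonempty r) fun v => I.dist v r).2 v hv

theorem dist_target_le_distTo (s : FrameworkState W) (r : W) :
    I.dist (s.target I r) r ≤ I.distTo (s.onAfter I r).F r :=
  I.le_distTo (OnlineState.step_F_nonempty r) fun _ hv =>
    dist_target_le r (s.onAfter_subset_openAfter r hv)

theorem Valid.step (h : s.Valid I) (r : W) : (s.step I PC γ Rhat r).Valid I := by
  classical
  have h0 := h.stepCost_nonneg r
  have hB := h.Bhat_nonneg.trans h.Bhat_le
  rcases le_or_gt (2 * s.Bhat) (s.B + s.stepCost I r) with hr | hr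
  · rw [step_of_le hr]
    exact ⟨Finset.Subset.refl _,
      Finset.union_subset (h.openAfter_subset r) (partialSol PC γ Rhat _).opened_subset,
      Finset.empty_subset _, OnlineState.valid_init fun _ _ => currentCost_nonneg _ _,
      add_nonneg hB h0, le_rfl⟩
  · rw [step_of_lt hr]
    exact ⟨h.Z_subset.trans (s.subset_openAfter r), h.openAfter_subset r,
      s.onAfter_subset_openAfter r, h.onAfter r, h.Bhat_nonneg,
      h.Bhat_le.trans (le_add_of_nonneg_right h0)⟩

/-- The online algorithm's opening and connection costs for one request. -/
theorem Valid.openAfter_cost_le (h : s.Valid I) (r : W) :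
    ∑ v ∈ s.openAfter I r, I.openCost v + I.dist (s.target I r) r +
        (s.onAfter I r).connection I ≤
      ∑ v ∈ s.S, I.openCost v + s.on.connection I + s.stepCost I r := by
  classical
  have h1 := h.on_valid.step_cost_le (fun _ _ => currentCost_nonneg _ _) r
  have h2 := s.dist_target_le_distTo (I := I) r
  have h3 : ∑ v ∈ s.openAfter I r, I.openCost v ≤
      ∑ v ∈ s.S, I.openCost v + ∑ v ∈ (s.onAfter I r).F \ s.on.F, s.currentCost I v := by
    -- Facilities already in `S` are not paid for again; those outside `S` lie outside `Z`, so the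
    -- online instance charges their true opening cost.
    have e : s.openAfter I r = s.S ∪ ((s.onAfter I r).F \ s.S) := by
      rw [Finset.union_sdiff_self_eq_union]
      rfl
    rw [e, Finset.sum_union Finset.disjoint_sdiff]
    gcongr
    calc ∑ v ∈ (s.onAfter I r).F \ s.S, I.openCost v
        = ∑ v ∈ (s.onAfter I r).F \ s.S, s.currentCost I v :=
          Finset.sum_congr rfl fun v hv => (currentCost_of_notMem fun hz =>
            (Finset.mem_sdiff.1 hv).2 (h.Z_subset hz)).symm
      _ ≤ _ := Finset.sum_le_sum_of_subset_of_nonneg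
          (Finset.sdiff_subset_sdiff le_rfl h.F_subset) fun v _ _ => currentCost_nonneg _ _
  unfold stepCost
  unfold FrameworkState.onAfter at h2 h3 ⊢
  linarith

/-- The potential is `B + 6γ * Bhat`. A purchase at value `b` costs at most `3γ * b`, and `Bhat`
rises to `b` from at most `b / 2`, which releases this amount. -/
theorem Valid.step_cost_le (h : s.Valid I) (hγ : 1 ≤ γ) (r : W) :
    ∑ v ∈ (s.step I PC γ Rhat r).S, I.openCost v + I.dist (s.target I r) r +
        (s.step I PC γ Rhat r).on.connection I +
        (s.B + 6 * γ * s.Bhat) ≤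
      ∑ v ∈ s.S, I.openCost v + s.on.connection I +
        ((s.step I PC γ Rhat r).B + 6 * γ * (s.step I PC γ Rhat r).Bhat) := by
  classical
  have h1 := h.openAfter_cost_le r
  rcases le_or_gt (2 * s.Bhat) (s.B + s.stepCost I r) with hr | hr
  · rw [step_of_le hr]
    dsimp only
    set b := s.B + s.stepCost I r with hb
    have hb0 : 0 ≤ b := add_nonneg (h.Bhat_nonneg.trans h.Bhat_le) (h.stepCost_nonneg r)
    have h2 := leastU_spec hγ PC Rhat hb0
    set P := partialSol PC γ Rhat (leastU PC γ Rhat b)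
    have h3 := P.sum_openCost_le_cost (Q := Rhat)
    have h4 : ∑ v ∈ s.openAfter I r ∪ P.opened, I.openCost v ≤
        ∑ v ∈ s.openAfter I r, I.openCost v + ∑ v ∈ P.opened, I.openCost v := by
      rw [← Finset.sum_union_inter]
      exact le_add_of_nonneg_right (Finset.sum_nonneg fun v _ => (I.openCost_pos v).le)
    have h5 : 3 * γ * (2 * s.Bhat) ≤ 3 * γ * b := by gcongr
    have h6 := (s.onAfter I r).connection_nonneg (I := I)
    rw [OnlineState.connection_init]
    linarith
  · rw [step_of_lt hr]
    dsimp only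
    linarith

end FrameworkState

/-! ### Phases between two purchases -/

section Run

variable {W : Type*} {I : UFLInstance W} {PC : PCAlgorithm I} {γ : ℝ} {m : ℕ} {Rhat : Fin m → W}
  {r : ℕ → W}

/-- The states of the framework on an infinite sequence of requests. -/
noncomputable def run (I : UFLInstance W) (PC : PCAlgorithm I) (γ : ℝ) {m : ℕ}
    (Rhat : Fin m → W) (r : ℕ → W) : ℕ → FrameworkState W
  | 0 => FrameworkState.init W
  | t + 1 => (run I PC γ Rhat r t).step I PC γ Rhat (r t)

theorem run_valid (t : ℕ) : (run I PC γ Rhat r t).Valid I := by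
  induction t with
  | zero => exact FrameworkState.valid_init I
  | succ t ih => exact ih.step _

theorem run_S_mono : Monotone fun t => (run I PC γ Rhat r t).S :=
  monotone_nat_of_le_succ fun _ =>
    (FrameworkState.subset_openAfter _ _).trans (FrameworkState.openAfter_subset_step _)

/-- This makes a single well-timed purchase useful in all later phases. -/
theorem run_Z_mono : Monotone fun t => (run I PC γ Rhat r t).Z :=
  monotone_nat_of_le_succ fun t => by
    classical
    dsimp only [run]
    set s := run I PC γ Rhat r t with hs
    rcases le_or_gt (2 * s.Bhat) (s.B + s.stepCost I (r t)) with h | h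
    · rw [FrameworkState.step_of_le h]
      exact (run_valid t).Z_subset.trans
        ((s.subset_openAfter _).trans Finset.subset_union_left)
    · rw [FrameworkState.step_of_lt h]

/-- The amortized cost of the request with index `t`. -/
noncomputable def runCost (I : UFLInstance W) (PC : PCAlgorithm I) (γ : ℝ) {m : ℕ}
    (Rhat : Fin m → W) (r : ℕ → W) (t : ℕ) : ℝ :=
  (run I PC γ Rhat r t).stepCost I (r t)

theorem run_succ_B (t : ℕ) :
    (run I PC γ Rhat r (t + 1)).B = (run I PC γ Rhat r t).B + runCost I PC γ Rhat r t :=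
  FrameworkState.step_B _

theorem run_cost_le (hγ : 1 ≤ γ) (t : ℕ) :
    ∑ v ∈ (run I PC γ Rhat r t).S, I.openCost v +
        ∑ j ∈ Finset.range t, I.dist ((run I PC γ Rhat r j).target I (r j)) (r j) ≤
      (1 + 6 * γ) * (run I PC γ Rhat r t).B := by
  have key : ∑ v ∈ (run I PC γ Rhat r t).S, I.openCost v +
        ∑ j ∈ Finset.range t, I.dist ((run I PC γ Rhat r j).target I (r j)) (r j) +
        (run I PC γ Rhat r t).on.connection I ≤
      (run I PC γ Rhat r t).B + 6 * γ * (run I PC γ Rhat r t).Bhat := by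
    induction t with
    | zero => simp [run, FrameworkState.init, OnlineState.connection_init]
    | succ t ih =>
      have := (run_valid (I := I) (PC := PC) (γ := γ) (Rhat := Rhat) (r := r) t).step_cost_le
        (PC := PC) (Rhat := Rhat) hγ (r t)
      rw [Finset.sum_range_succ]
      simp only [run]
      linarith
  have h1 := (run I PC γ Rhat r t).on.connection_nonneg (I := I)
  have h2 := mul_le_mul_of_nonneg_left
    (run_valid (I := I) (PC := PC) (γ := γ) (Rhat := Rhat) (r := r) t).Bhat_le
    (by positivity : 0 ≤ 6 * γ)
  linarith

/-- `t` belongs to a phase (the lifetime of an instance of the online algorithm) that starts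
with the request of index `τ`. -/
structure IsPhase (I : UFLInstance W) (PC : PCAlgorithm I) (γ : ℝ) {m : ℕ} (Rhat : Fin m → W)
    (r : ℕ → W) (τ t : ℕ) : Prop where
  le : τ ≤ t
  on_eq : (run I PC γ Rhat r τ).on = OnlineState.init W
  B_eq : (run I PC γ Rhat r τ).B = (run I PC γ Rhat r τ).Bhat
  lt : ∀ j, τ ≤ j → j < t →
    (run I PC γ Rhat r (j + 1)).B < 2 * (run I PC γ Rhat r j).Bhat

namespace IsPhase

variable {τ t j : ℕ}

theorem run_succ (h : IsPhase I PC γ Rhat r τ t) (hj : τ ≤ j) (hj' : j < t) :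
    run I PC γ Rhat r (j + 1) =
      ⟨(run I PC γ Rhat r (j + 1)).B, (run I PC γ Rhat r j).Bhat,
        (run I PC γ Rhat r j).openAfter I (r j), (run I PC γ Rhat r j).Z,
        (run I PC γ Rhat r j).onAfter I (r j)⟩ := by
  have := h.lt j hj hj'
  rw [run_succ_B] at this ⊢
  exact FrameworkState.step_of_lt this

theorem state (h : IsPhase I PC γ Rhat r τ t) {j : ℕ} (hj : τ ≤ j) (hj' : j ≤ t) :
    (run I PC γ Rhat r j).Bhat = (run I PC γ Rhat r τ).Bhat ∧
    (run I PC γ Rhat r j).B =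
      (run I PC γ Rhat r τ).Bhat + ∑ i ∈ Finset.Ico τ j, runCost I PC γ Rhat r i ∧
    ∀ g : W → ℝ, ((run I PC γ Rhat r j).on.L.map g).sum = ∑ i ∈ Finset.Ico τ j, g (r i) := by
  induction j, hj using Nat.le_induction with
  | base => simp [h.on_eq, h.B_eq, OnlineState.init]
  | succ j hj ih =>
    obtain ⟨h1, h2, h3⟩ := ih (by omega)
    refine ⟨?_, ?_, fun g => ?_⟩
    · rw [h.run_succ hj (by omega)]
      exact h1
    · rw [run_succ_B, h2, Finset.sum_Ico_succ_top hj, add_assoc]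
    · rw [h.run_succ hj (by omega), Finset.sum_Ico_succ_top hj, ← h3 g]
      simp [FrameworkState.onAfter, OnlineState.step_L, add_comm]

/-- The amortized cost of requests of a phase, compared with the facility `v`. -/
theorem sum_le (h : IsPhase I PC γ Rhat r τ t) {v : W} (hv : v ∈ I.sites) {A : Finset ℕ}
    (hA : A ⊆ Finset.Icc τ t) :
    ∑ i ∈ A, runCost I PC γ Rhat r i ≤
      2 * (1 + 2 * harmonic A.card) * (I.openCost v + ∑ i ∈ A, I.dist v (r i)) := by
  have := sum_le_harmonic_mul (A := A) (a := fun i => runCost I PC γ Rhat r i / 2)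
    (d := fun i => I.dist v (r i)) (I.openCost_pos v).le (fun i => I.dist_nonneg _ _) ?_
  · rw [← Finset.sum_div] at this
    linarith
  intro i hi
  obtain ⟨hi1, hi2⟩ := Finset.mem_Icc.1 (hA hi)
  have h1 := (run_valid (I := I) (PC := PC) (γ := γ) (Rhat := Rhat) (r := r)
    i).on_valid.amortizedCost_le_div (A := {j ∈ A | j < i}) (q := r) hv (r i) ?_
  · have h2 : ((run I PC γ Rhat r i).currentCost I v +
        2 * ∑ j ∈ A with j < i, I.dist v (r j)) / ({j ∈ A | j < i}.card + 1) ≤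
        (I.openCost v + 2 * ∑ j ∈ A with j < i, I.dist v (r j)) /
          ({j ∈ A | j < i}.card + 1) := by
      gcongr
      exact FrameworkState.currentCost_le _ _
    change runCost I PC γ Rhat r i ≤ _ at h1
    linarith
  · intro g hg
    rw [(h.state hi1 hi2).2.2 g]
    refine Finset.sum_le_sum_of_subset_of_nonneg (fun j hj => ?_) fun j _ _ => hg _
    obtain ⟨hj1, hj2⟩ := Finset.mem_filter.1 hj
    exact Finset.mem_Ico.2 ⟨(Finset.mem_Icc.1 (hA hj1)).1, hj2⟩

/-- The amortized cost of requests of a phase, compared with any solution. -/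
theorem sum_le_of_solution (h : IsPhase I PC γ Rhat r τ t) {O : Finset W} (hO : O ⊆ I.sites)
    {A : Finset ℕ} (hA : A ⊆ Finset.Icc τ t) {c : ℕ → W} (hc : ∀ i ∈ A, c i ∈ O) :
    ∑ i ∈ A, runCost I PC γ Rhat r i ≤
      2 * (1 + 2 * harmonic A.card) *
        (∑ v ∈ O, I.openCost v + ∑ i ∈ A, I.dist (c i) (r i)) := by
  classical
  -- Group the requests by their facility in `O`; each group is charged its opening cost once.
  rw [← Finset.sum_fiberwise_of_maps_to hc, ← Finset.sum_fiberwise_of_maps_to hc,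
    ← Finset.sum_add_distrib, Finset.mul_sum]
  refine Finset.sum_le_sum fun v hv => ?_
  have h1 := h.sum_le (hO hv) ((Finset.filter_subset (fun i => c i = v) A).trans hA)
  have h2 : ∑ i ∈ A with c i = v, I.dist (c i) (r i) = ∑ i ∈ A with c i = v, I.dist v (r i) :=
    Finset.sum_congr rfl fun i hi => by rw [(Finset.mem_filter.1 hi).2]
  rw [h2]
  refine h1.trans (mul_le_mul_of_nonneg_right ?_ ?_)
  · have : harmonic {i ∈ A | c i = v}.card ≤ harmonic A.card :=
      harmonic_mono (Finset.card_le_card (Finset.filter_subset _ _))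
    have : (harmonic {i ∈ A | c i = v}.card : ℝ) ≤ harmonic A.card := by exact_mod_cast this
    linarith
  · exact add_nonneg (I.openCost_pos v).le (Finset.sum_nonneg fun i _ => I.dist_nonneg _ _)

end IsPhase

theorem isPhase_self_of_le {t : ℕ}
    (h : 2 * (run I PC γ Rhat r t).Bhat ≤ (run I PC γ Rhat r (t + 1)).B) :
    IsPhase I PC γ Rhat r (t + 1) (t + 1) := by
  rw [run_succ_B] at h
  refine ⟨le_rfl, ?_, ?_, fun j hj hj' => absurd hj (not_le.2 hj')⟩ <;>
  · rw [run, FrameworkState.step_of_le h]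

theorem run_succ_Bhat_of_le {t : ℕ}
    (h : 2 * (run I PC γ Rhat r t).Bhat ≤ (run I PC γ Rhat r (t + 1)).B) :
    (run I PC γ Rhat r (t + 1)).Bhat = (run I PC γ Rhat r (t + 1)).B :=
  (isPhase_self_of_le h).B_eq.symm

theorem run_succ_Bhat_of_lt {t : ℕ}
    (h : (run I PC γ Rhat r (t + 1)).B < 2 * (run I PC γ Rhat r t).Bhat) :
    (run I PC γ Rhat r (t + 1)).Bhat = (run I PC γ Rhat r t).Bhat := by
  rw [run_succ_B] at h
  rw [run, FrameworkState.step_of_lt h]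

theorem opened_subset_run_succ_Z {t : ℕ}
    (h : 2 * (run I PC γ Rhat r t).Bhat ≤ (run I PC γ Rhat r (t + 1)).B) :
    (partialSol PC γ Rhat (leastU PC γ Rhat (run I PC γ Rhat r (t + 1)).B)).opened ⊆
      (run I PC γ Rhat r (t + 1)).Z := by
  classical
  rw [run_succ_B] at h ⊢
  rw [run, FrameworkState.step_of_le h]
  exact Finset.subset_union_right

/-- If every phase after `t₀` costs at most `X`, then the total amortized cost is bounded. -/
theorem run_B_le_of_phases {t₀ n : ℕ} (h₀ : IsPhase I PC γ Rhat r t₀ t₀) {X : ℝ} (hX : 0 ≤ X)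
    (h : ∀ τ t, t₀ ≤ τ → t < n → IsPhase I PC γ Rhat r τ t →
      ∑ i ∈ Finset.Icc τ t, runCost I PC γ Rhat r i ≤ X) {t : ℕ} (ht : t₀ ≤ t) (htn : t ≤ n) :
    (run I PC γ Rhat r t).B ≤ (run I PC γ Rhat r t₀).B + 3 * X := by
  suffices H : (∃ τ, t₀ ≤ τ ∧ IsPhase I PC γ Rhat r τ t) ∧
      (run I PC γ Rhat r t).Bhat ≤ (run I PC γ Rhat r t₀).B + 2 * X ∧
      (run I PC γ Rhat r t).B ≤ (run I PC γ Rhat r t).Bhat + X by linarith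
  induction t, ht using Nat.le_induction with
  | base => exact ⟨⟨t₀, le_rfl, h₀⟩, by rw [h₀.B_eq]; linarith, by rw [h₀.B_eq]; linarith⟩
  | succ t ht ih =>
    obtain ⟨⟨τ, hτ, hph⟩, h1, h2⟩ := ih (by omega)
    have h3 := h τ t hτ (by omega) hph
    obtain ⟨e1, e2, -⟩ := hph.state hph.le le_rfl
    -- The request that triggers a purchase still counts towards the phase it ends.
    have h4 : (run I PC γ Rhat r (t + 1)).B ≤ (run I PC γ Rhat r t).Bhat + X := by
      rw [run_succ_B, e2, e1, add_assoc, ← Finset.sum_Ico_succ_top hph.le]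
      gcongr
      exact h3
    rcases le_or_gt (2 * (run I PC γ Rhat r t).Bhat) (run I PC γ Rhat r (t + 1)).B with hr | hr
    · refine ⟨⟨t + 1, by omega, isPhase_self_of_le hr⟩, ?_, ?_⟩
      -- A purchase means `2 * Bhat ≤ B`, and `B ≤ Bhat + X`; hence `Bhat ≤ X`, and the new value is
      -- at most `2 * X`.
      · rw [run_succ_Bhat_of_le hr]
        have := h₀.B_eq
        have := (run_valid (I := I) (PC := PC) (γ := γ) (Rhat := Rhat) (r := r) t₀).Bhat_nonneg
        linarith
      · rw [run_succ_Bhat_of_le hr]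
        linarith
    · refine ⟨⟨τ, hτ, ⟨hph.le.trans (Nat.le_succ t), hph.on_eq, hph.B_eq, fun j hj hj' => ?_⟩⟩,
        ?_, ?_⟩
      · rcases Nat.lt_succ_iff_lt_or_eq.1 hj' with hj' | rfl
        · exact hph.lt j hj hj'
        · exact hr
      · rw [run_succ_Bhat_of_lt hr]
        exact h1
      · rw [run_succ_Bhat_of_lt hr]
        exact h4

/-- Either the total amortized cost is at most `2Y`, or a phase starts when it is between `Y` and
`4Y`. -/
theorem exists_isPhase_of_lt {n : ℕ} {Y : ℝ} (hY : 0 ≤ Y)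
    (h : ∀ t < n, runCost I PC γ Rhat r t ≤ 2 * Y) (hB : 2 * Y < (run I PC γ Rhat r n).B) :
    ∃ t₀ ≤ n, IsPhase I PC γ Rhat r t₀ t₀ ∧ Y ≤ (run I PC γ Rhat r t₀).B ∧
      (run I PC γ Rhat r t₀).B ≤ 4 * Y ∧
      (partialSol PC γ Rhat (leastU PC γ Rhat (run I PC γ Rhat r t₀).B)).opened ⊆
        (run I PC γ Rhat r t₀).Z := by
  by_contra! hno
  -- While `Bhat ≤ Y`, a step without purchase keeps `B < 2 * Y`. The first purchase above `Y` would
  -- happen at most one request later, so at `B ≤ 4 * Y`, and is the one excluded by `hno`.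
  suffices H : ∀ t ≤ n, (run I PC γ Rhat r t).Bhat ≤ Y ∧ (run I PC γ Rhat r t).B ≤ 2 * Y from
    absurd (H n le_rfl).2 (not_le.2 hB)
  intro t ht
  induction t with
  | zero => simp [run, FrameworkState.init, hY]
  | succ t ih =>
    obtain ⟨h1, h2⟩ := ih (by omega)
    rcases le_or_gt (2 * (run I PC γ Rhat r t).Bhat) (run I PC γ Rhat r (t + 1)).B with hr | hr
    · rw [run_succ_Bhat_of_le hr]
      have h3 : (run I PC γ Rhat r (t + 1)).B ≤ Y := by
        by_contra! hc
        refine hno (t + 1) ht (isPhase_self_of_le hr) hc.le ?_ (opened_subset_run_succ_Z hr)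
        have := h t (by omega)
        rw [run_succ_B]
        linarith
      exact ⟨h3, by linarith⟩
    · rw [run_succ_Bhat_of_lt hr]
      exact ⟨h1, by linarith⟩

end Run

/-! ### The total amortized cost -/

section Run

variable {W : Type*} {I : UFLInstance W} {PC : PCAlgorithm I} {γ : ℝ} {m : ℕ} {Rhat : Fin m → W}
  {n : ℕ}

/-- Passing to sequences on `ℕ` turns phases into integer intervals; the values from `n` on never
matter. -/
theorem exists_extension {α : Type*} [Nonempty α] (g : Fin n → α) :
    ∃ G : ℕ → α, ∀ i : Fin n, G i = g i :=
  ⟨Function.extend Fin.val g fun _ => Classical.arbitrary α, Fin.val_injective.extend_apply g _⟩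

theorem frameworkState_eq_run {R : Fin n → W} {r : ℕ → W} (hr : ∀ i : Fin n, r i = R i) {t : ℕ}
    (ht : t ≤ n) : frameworkState I PC γ Rhat R t = run I PC γ Rhat r t := by
  induction t with
  | zero => rfl
  | succ t ih =>
    have h : t < n := ht
    rw [frameworkState, dif_pos h, ih h.le, run, ← hr ⟨t, h⟩]

theorem frameworkState_step (R : Fin n → W) (i : Fin n) :
    frameworkState I PC γ Rhat R (i + 1) =
      (frameworkState I PC γ Rhat R i).step I PC γ Rhat (R i) :=
  dif_pos i.2

theorem frameworkState_S_subset (R : Fin n → W) {t t' : ℕ} (h : t ≤ t') (ht' : t' ≤ n) :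
    (frameworkState I PC γ Rhat R t).S ⊆ (frameworkState I PC γ Rhat R t').S := by
  have := I.connected.nonempty
  obtain ⟨r, hr⟩ := exists_extension R
  rw [frameworkState_eq_run hr (h.trans ht'), frameworkState_eq_run hr ht']
  exact run_S_mono h

theorem frameworkState_valid (R : Fin n → W) {t : ℕ} (ht : t ≤ n) :
    (frameworkState I PC γ Rhat R t).Valid I := by
  have := I.connected.nonempty
  obtain ⟨r, hr⟩ := exists_extension R
  rw [frameworkState_eq_run hr ht]
  exact run_valid t

theorem frameworkTarget_mem (R : Fin n → W) (i : Fin n) :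
    frameworkTarget I PC γ Rhat R i ∈ (frameworkState I PC γ Rhat R (i + 1)).S := by
  rw [frameworkState_step]
  exact FrameworkState.openAfter_subset_step _ (FrameworkState.target_mem _ _)

theorem uflAlgorithm_feasible (PC : PCAlgorithm I) (γ : ℝ) (Rhat : Fin m → W) (R : Fin n → W) :
    (uflAlgorithm I PC γ Rhat R).Feasible I :=
  ⟨(frameworkState_valid R le_rfl).S_subset, fun i =>
    frameworkState_S_subset R i.2 le_rfl (frameworkTarget_mem R i)⟩

theorem uflAlgorithm_cost_le_run (hγ : 1 ≤ γ) {R : Fin n → W} {r : ℕ → W}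
    (hr : ∀ i : Fin n, r i = R i) :
    (uflAlgorithm I PC γ Rhat R).cost I R ≤ (1 + 6 * γ) * (run I PC γ Rhat r n).B := by
  refine le_trans (le_of_eq ?_) (run_cost_le hγ n)
  rw [UFLSolution.cost, uflAlgorithm, frameworkState_eq_run hr le_rfl,
    ← Fin.sum_univ_eq_sum_range fun j => I.dist ((run I PC γ Rhat r j).target I (r j)) (r j)]
  congr 1
  refine Finset.sum_congr rfl fun i _ => ?_
  change I.dist (R i) ((frameworkState I PC γ Rhat R i).target I (R i)) = _
  rw [frameworkState_eq_run hr i.2.le, hr, I.dist_symm]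

/-- All requests but those in a set of at most `k` are close to `O`, at total distance at most
`E`. -/
def CloseToAllBut (I : UFLInstance W) (R : Fin n → W) (O : Finset W) (k : ℕ) (E : ℝ) : Prop :=
  ∃ (A : Finset (Fin n)) (e : Fin n → ℝ), A.card ≤ k ∧ (∀ j, 0 ≤ e j) ∧
    (∀ j, j ∉ A → ∃ v ∈ O, I.dist v (R j) ≤ e j) ∧ ∑ j, e j ≤ E

/-- The cost of a phase in which facilities of cost `0` are close to all but `k` requests. -/
theorem IsPhase.sum_le_of_closeToAllBut {R : Fin n → W} {r : ℕ → W}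
    (hr : ∀ i : Fin n, r i = R i) {t₀ τ t : ℕ} (h : IsPhase I PC γ Rhat r τ t) (hτ : t₀ ≤ τ)
    (ht : t < n) {T : UFLSolution W n} (hT : T.Feasible I) {O : Finset W}
    (hO : O ⊆ (run I PC γ Rhat r t₀).Z) {k : ℕ} {E : ℝ} (hE : CloseToAllBut I R O k E) :
    ∑ i ∈ Finset.Icc τ t, runCost I PC γ Rhat r i ≤
      2 * E + 2 * (1 + 2 * harmonic k) * T.cost I R := by
  have := I.connected.nonempty
  obtain ⟨A, e, hA, he, hclose, hsum⟩ := hE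
  obtain ⟨c, hc⟩ := exists_extension T.assign
  obtain ⟨e', he'⟩ := exists_extension e
  set P := Finset.Icc τ t with hP
  have hPn : P ⊆ Finset.range n := fun i hi => by
    have := (Finset.mem_Icc.1 hi).2
    exact Finset.mem_range.2 (by omega)
  set A' : Finset ℕ := A.map Fin.valEmbedding
  rw [← Finset.sum_filter_add_sum_filter_not P (· ∈ A')]
  have hsub : {i ∈ P | i ∈ A'} ⊆ P := Finset.filter_subset _ _
  have hdist : ∑ i ∈ P with i ∈ A', I.dist (c i) (r i) ≤ ∑ i, I.dist (R i) (T.assign i) := by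
    calc ∑ i ∈ P with i ∈ A', I.dist (c i) (r i) ≤ ∑ i ∈ Finset.range n, I.dist (c i) (r i) :=
          Finset.sum_le_sum_of_subset_of_nonneg (hsub.trans hPn) fun i _ _ => I.dist_nonneg _ _
      _ = ∑ i, I.dist (R i) (T.assign i) := by
          rw [← Fin.sum_univ_eq_sum_range fun i => I.dist (c i) (r i)]
          exact Finset.sum_congr rfl fun i _ => by rw [hc, hr, I.dist_symm]
  have h1 := h.sum_le_of_solution hT.1 hsub (c := c) fun i hi => by
    have hi := Finset.mem_range.1 (hPn (hsub hi))
    rw [hc ⟨i, hi⟩]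
    exact hT.2 _
  have hcard : (harmonic {i ∈ P | i ∈ A'}.card : ℝ) ≤ harmonic k := by
    refine Rat.cast_le.2 (harmonic_mono (le_trans (Finset.card_le_card (t := A') ?_) ?_))
    · exact fun i hi => (Finset.mem_filter.1 hi).2
    · rwa [Finset.card_map]
  have h0 : (0 : ℝ) ≤ harmonic {i ∈ P | i ∈ A'}.card := by
    exact_mod_cast (harmonic_zero ▸ harmonic_mono (Nat.zero_le _) :
      (0 : ℚ) ≤ harmonic {i ∈ P | i ∈ A'}.card)
  have h2 : ∑ i ∈ P with i ∈ A', runCost I PC γ Rhat r i ≤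
      2 * (1 + 2 * harmonic k) * T.cost I R := by
    refine h1.trans ?_
    unfold UFLSolution.cost
    refine mul_le_mul (by linarith) (by gcongr) (add_nonneg ?_ ?_) (by linarith)
    · exact Finset.sum_nonneg fun v _ => (I.openCost_pos v).le
    · exact Finset.sum_nonneg fun i _ => I.dist_nonneg _ _
  have h3 : ∑ i ∈ P with i ∉ A', runCost I PC γ Rhat r i ≤ 2 * E := by
    calc ∑ i ∈ P with i ∉ A', runCost I PC γ Rhat r i ≤ ∑ i ∈ P with i ∉ A', 2 * e' i := by
          refine Finset.sum_le_sum fun i hi => ?_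
          obtain ⟨hi1, hi2⟩ := Finset.mem_filter.1 hi
          have hin := Finset.mem_range.1 (hPn hi1)
          obtain ⟨v, hv, hve⟩ := hclose ⟨i, hin⟩ fun hmem =>
            hi2 (Finset.mem_map.2 ⟨_, hmem, rfl⟩)
          -- The nearby facility `v` is free in this phase, so the amortized cost is at most twice
          -- its distance.
          have hvZ := run_Z_mono (hτ.trans (Finset.mem_Icc.1 hi1).1) (hO hv)
          have hval := run_valid (I := I) (PC := PC) (γ := γ) (Rhat := Rhat) (r := r) i
          have := hval.stepCost_le (hval.S_subset (hval.Z_subset hvZ)) (r i)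
          rw [FrameworkState.currentCost_of_mem hvZ] at this
          rw [← hr, ← he'] at hve
          unfold runCost
          dsimp only at hve
          linarith
      _ ≤ ∑ i ∈ Finset.range n, 2 * e' i := by
          refine Finset.sum_le_sum_of_subset_of_nonneg ((Finset.filter_subset _ _).trans hPn)
            fun i hi _ => ?_
          have := he ⟨i, Finset.mem_range.1 hi⟩
          rw [← he'] at this
          dsimp only at this
          linarith
      _ = 2 * ∑ i, e i := by
          rw [← Finset.mul_sum, ← Fin.sum_univ_eq_sum_range fun i => e' i]
          simp only [he']
      _ ≤ 2 * E := by linarith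
  linarith

namespace UFLSolution

theorem cost_nonneg (T : UFLSolution W n) (R : Fin n → W) : 0 ≤ T.cost I R :=
  add_nonneg (Finset.sum_nonneg fun v _ => (I.openCost_pos v).le)
    (Finset.sum_nonneg fun _ _ => I.dist_nonneg _ _)

theorem Feasible.openCost_add_dist_le {T : UFLSolution W n} (hT : T.Feasible I) (R : Fin n → W)
    (i : Fin n) : I.openCost (T.assign i) + I.dist (T.assign i) (R i) ≤ T.cost I R := by
  refine add_le_add (Finset.single_le_sum (fun v _ => (I.openCost_pos v).le) (hT.2 i)) ?_
  rw [I.dist_symm]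
  exact Finset.single_le_sum (f := fun i => I.dist (R i) (T.assign i))
    (fun _ _ => I.dist_nonneg _ _) (Finset.mem_univ i)

end UFLSolution

/-- The total amortized cost when every cheap solution of the prediction that satisfies almost as
many predicted requests as `U` is close to all but `k` requests. -/
theorem run_B_le (hγ : 1 ≤ γ) (hPC : PC.IsApprox γ) {R : Fin n → W} {r : ℕ → W}
    (hr : ∀ i : Fin n, r i = R i) {T : UFLSolution W n} (hT : T.Feasible I) {Y : ℝ}
    (hY : T.cost I R ≤ Y) {U : PCSolution I m} (hU : U.cost Rhat ≤ Y) {k : ℕ} {E : ℝ}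
    (hE : 0 ≤ E)
    (hclose : ∀ P : PCSolution I m, (P.unsatisfied.card : ℝ) ≤ 2 * γ * U.unsatisfied.card →
      P.cost Rhat ≤ 12 * γ * Y → CloseToAllBut I R P.opened k E) :
    (run I PC γ Rhat r n).B ≤ 4 * Y + 3 * (2 * E + 2 * (1 + 2 * harmonic k) * T.cost I R) := by
  have hK := T.cost_nonneg (I := I) R
  have hH : (0 : ℝ) ≤ harmonic k := by
    exact_mod_cast (harmonic_zero ▸ harmonic_mono (Nat.zero_le k) : (0 : ℚ) ≤ _)
  have hX : 0 ≤ 2 * E + 2 * (1 + 2 * harmonic k) * T.cost I R := by positivity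
  rcases le_or_gt (run I PC γ Rhat r n).B (2 * Y) with hB | hB
  · linarith
  -- No request costs more than opening its own facility of `T` and connecting to it, up to the
  -- factor 2.
  have hcost : ∀ t < n, runCost I PC γ Rhat r t ≤ 2 * Y := by
    intro t ht
    have h1 := hT.openCost_add_dist_le R ⟨t, ht⟩
    have h2 := (run_valid (I := I) (PC := PC) (γ := γ) (Rhat := Rhat) (r := r) t).stepCost_le
      (hT.1 (hT.2 ⟨t, ht⟩)) (r t)
    have h3 := (run I PC γ Rhat r t).currentCost_le (I := I) (T.assign ⟨t, ht⟩)
    rw [← hr] at h1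
    dsimp only at h1
    unfold runCost
    linarith
  obtain ⟨t₀, ht₀, hph, hlow, hhigh, hsub⟩ := exists_isPhase_of_lt (hK.trans hY) hcost hB
  have hb : 0 ≤ (run I PC γ Rhat r t₀).B := hK.trans (hY.trans hlow)
  -- The purchase at `t₀` happens late enough (`B ≥ Y`) to do about as well as `U`, and early enough
  -- (`B ≤ 4 * Y`) to cost at most `3γ * 4Y`.
  have hP := hclose _ (card_unsatisfied_leastU_le hγ hPC (hU.trans hlow)) (by
    refine (leastU_spec hγ PC Rhat hb).trans ?_
    have : 3 * γ * (run I PC γ Rhat r t₀).B ≤ 3 * γ * (4 * Y) := by gcongr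
    linarith)
  have := run_B_le_of_phases hph hX (fun τ t hτ ht h =>
    h.sum_le_of_closeToAllBut hr hτ ht hT hsub hP) ht₀ le_rfl
  linarith

end Run

/-! ### Transfer between requests and predictions -/

section Matching

variable {W : Type*} {I : UFLInstance W} {m : ℕ} {Rhat : Fin m → W} {n : ℕ} {R : Fin n → W}
  {M : Finset (Fin n)} {Mhat : Finset (Fin m)} (σ : M ≃ Mhat)

theorem sum_dite_mem {ι : Type*} [Fintype ι] [DecidableEq ι] (s : Finset ι) (g : s → ℝ) :
    (∑ i, if h : i ∈ s then g ⟨i, h⟩ else 0) = ∑ x : s, g x := by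
  rw [← Finset.sum_subset (Finset.subset_univ s) fun i _ hi => dif_neg hi, ← Finset.sum_coe_sort]
  exact Finset.sum_congr rfl fun x _ => dif_pos x.2

/-- A matching of requests and predicted requests turns a solution for the requests into one for
the predicted requests. -/
def matchedSolution {T : UFLSolution W n} (hT : T.Feasible I) : PCSolution I m where
  opened := T.opened
  opened_subset := hT.1
  assign j := if h : j ∈ Mhat then some (T.assign (σ.symm ⟨j, h⟩)) else none
  assign_mem j v h := by
    split_ifs at h with hj
    rw [← Option.some.inj h]
    exact hT.2 _

theorem unsatisfied_matchedSolution {T : UFLSolution W n} (hT : T.Feasible I) :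
    (matchedSolution σ hT).unsatisfied = Mhatᶜ := by
  ext j
  by_cases hj : j ∈ Mhat <;> simp [PCSolution.mem_unsatisfied, matchedSolution, hj]

theorem cost_matchedSolution_le {T : UFLSolution W n} (hT : T.Feasible I) :
    (matchedSolution σ hT).cost Rhat ≤
      T.cost I R + ∑ x : M, I.dist (R x) (Rhat (σ x)) := by
  have h1 : ∑ j, (((matchedSolution σ hT).assign j).map fun v => I.dist (Rhat j) v).getD 0 =
      ∑ x : M, I.dist (Rhat (σ x)) (T.assign x) := by
    rw [← Equiv.sum_comp σ.symm fun x => I.dist (Rhat (σ x)) (T.assign x)]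
    simp only [Equiv.apply_symm_apply]
    rw [← sum_dite_mem Mhat fun y => I.dist (Rhat y) (T.assign (σ.symm y))]
    refine Finset.sum_congr rfl fun j _ => ?_
    by_cases hj : j ∈ Mhat <;> simp [matchedSolution, hj]
  have h2 : ∑ x : M, I.dist (Rhat (σ x)) (T.assign x) ≤
      ∑ x : M, I.dist (R x) (Rhat (σ x)) + ∑ x : M, I.dist (R x) (T.assign x) := by
    rw [← Finset.sum_add_distrib]
    refine Finset.sum_le_sum fun x _ => ?_
    rw [I.dist_symm (R x) (Rhat (σ x))]
    exact I.dist_triangle _ _ _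
  have h3 : ∑ x : M, I.dist (R x) (T.assign x) ≤ ∑ i, I.dist (R i) (T.assign i) := by
    rw [Finset.sum_coe_sort M fun i => I.dist (R i) (T.assign i)]
    exact Finset.sum_le_sum_of_subset_of_nonneg (Finset.subset_univ _)
      fun _ _ _ => I.dist_nonneg _ _
  unfold PCSolution.cost UFLSolution.cost
  rw [h1]
  change ∑ v ∈ T.opened, I.openCost v + _ ≤ _
  linarith

/-- A matched request whose partner is satisfied by `P` reaches a facility through its partner. The
exceptions are the unmatched requests, included vacuously by the condition `∀ h : i ∈ M, …`, and
those with an unsatisfied partner. -/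
theorem closeToAllBut_of_matching (P : PCSolution I m) {k : ℕ}
    (hk : min n (Mᶜ.card + P.unsatisfied.card) ≤ k) :
    CloseToAllBut I R P.opened k (∑ x : M, I.dist (R x) (Rhat (σ x)) + P.cost Rhat) := by
  classical
  set g : Fin m → ℝ := fun j => ((P.assign j).map fun v => I.dist (Rhat j) v).getD 0
  have hg : ∀ j, 0 ≤ g j := P.connection_term_nonneg
  refine ⟨Finset.univ.filter fun i => ∀ h : i ∈ M, P.assign (σ ⟨i, h⟩) = none,
    fun i => if h : i ∈ M then I.dist (R i) (Rhat (σ ⟨i, h⟩)) + g (σ ⟨i, h⟩) else 0,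
    le_trans (le_min ?_ ?_) hk, fun i => ?_, fun i hi => ?_, ?_⟩
  · exact (Finset.card_le_univ _).trans_eq (Fintype.card_fin n)
  · have hsub : (Finset.univ.filter fun i => ∀ h : i ∈ M, P.assign (σ ⟨i, h⟩) = none) ⊆
        Mᶜ ∪ (Finset.univ.filter fun y : Mhat => (y : Fin m) ∈ P.unsatisfied).image
          fun y => (σ.symm y : Fin n) := by
      intro i hi
      rw [Finset.mem_filter] at hi
      by_cases hM : i ∈ M
      · refine Finset.mem_union_right _ (Finset.mem_image.2 ⟨σ ⟨i, hM⟩, ?_, by simp⟩)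
        simpa [PCSolution.mem_unsatisfied] using hi.2 hM
      · exact Finset.mem_union_left _ (by simpa)
    refine (Finset.card_le_card hsub).trans ((Finset.card_union_le _ _).trans ?_)
    refine Nat.add_le_add_left (Finset.card_image_le.trans ?_) _
    exact Finset.card_le_card_of_injOn Subtype.val (fun y hy => by simpa using hy)
      Subtype.val_injective.injOn
  · dsimp only
    split_ifs
    · exact add_nonneg (I.dist_nonneg _ _) (hg _)
    · exact le_rfl
  · simp only [Finset.mem_filter, Finset.mem_univ, true_and, not_forall] at hi
    obtain ⟨hM, hne⟩ := hi
    obtain ⟨v, hv⟩ := Option.ne_none_iff_exists'.1 hne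
    refine ⟨v, P.assign_mem _ v hv, ?_⟩
    dsimp only
    rw [dif_pos hM]
    have : g (σ ⟨i, hM⟩) = I.dist (Rhat (σ ⟨i, hM⟩)) v := by simp [g, hv]
    rw [this, I.dist_symm]
    exact I.dist_triangle _ _ _
  · rw [sum_dite_mem M fun x => I.dist (R x) (Rhat (σ x)) + g (σ x), Finset.sum_add_distrib,
      Equiv.sum_comp σ fun y => g y]
    gcongr
    refine le_trans ?_ P.sum_connection_le_cost
    rw [Finset.sum_coe_sort Mhat g]
    exact Finset.sum_le_sum_of_subset_of_nonneg (Finset.subset_univ _) fun j _ _ => hg j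

end Matching

/-! ### The guarantee for the uncapacitated problem -/

theorem harmonic_floor_le {γ x : ℝ} (hγ : 1 ≤ γ) (hx : 0 ≤ x) :
    (harmonic ⌊(1 + 2 * γ) * x⌋₊ : ℝ) ≤ 1 + 2 * γ + Real.log (x + 2) := by
  have h0 : 0 ≤ Real.log (x + 2) := Real.log_nonneg (by linarith)
  refine (harmonic_le_one_add_log _).trans ?_
  -- For floor 0 the bound `1 + log 0` equals 1 by the convention `Real.log 0 = 0`.
  rcases Nat.eq_zero_or_pos ⌊(1 + 2 * γ) * x⌋₊ with h | h
  · rw [h]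
    simp only [Nat.cast_zero, Real.log_zero]
    linarith
  have h1 : (⌊(1 + 2 * γ) * x⌋₊ : ℝ) ≤ (1 + 2 * γ) * (x + 2) :=
    (Nat.floor_le (by positivity)).trans (by gcongr; linarith)
  have h2 := Real.log_le_log (by exact_mod_cast h) h1
  rw [Real.log_mul (by positivity) (by positivity)] at h2
  have h3 := Real.log_le_sub_one_of_pos (by linarith : 0 < 1 + 2 * γ)
  linarith

theorem half_le_log_add_two {x : ℝ} (hx : 0 ≤ x) : 1 / 2 ≤ Real.log (x + 2) := by
  have h1 := Real.log_two_gt_d9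
  have h2 := Real.log_le_log two_pos (by linarith : (2 : ℝ) ≤ x + 2)
  linarith

/-- The guarantee of the framework for uncapacitated facility location with predictions, for a
matching of all but `Δ` of the requests and predicted requests. -/
theorem uflAlgorithm_cost_le {W : Type*} {I : UFLInstance W} {PC : PCAlgorithm I} {γ : ℝ}
    (hγ : 1 ≤ γ) (hPC : PC.IsApprox γ) {m : ℕ} {Rhat : Fin m → W} {n : ℕ} {R : Fin n → W}
    {M : Finset (Fin n)} {Mhat : Finset (Fin m)} (σ : M ≃ Mhat) {T : UFLSolution W n}
    (hT : T.Feasible I) :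
    (uflAlgorithm I PC γ Rhat R).cost I R ≤
      (1 + 6 * γ) * (56 + 192 * γ) *
        (Real.log (min (n : ℝ) ((Mᶜ.card + Mhatᶜ.card : ℕ) : ℝ) + 2) * T.cost I R +
          ∑ x : M, I.dist (R x) (Rhat (σ x))) := by
  have := I.connected.nonempty
  obtain ⟨r, hr⟩ := exists_extension R
  set D := ∑ x : M, I.dist (R x) (Rhat (σ x)) with hD
  have hD0 : 0 ≤ D := Finset.sum_nonneg fun _ _ => I.dist_nonneg _ _
  set x : ℝ := min (n : ℝ) ((Mᶜ.card + Mhatᶜ.card : ℕ) : ℝ) with hx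
  have hx0 : 0 ≤ x := le_min (Nat.cast_nonneg _) (Nat.cast_nonneg _)
  have hK := T.cost_nonneg (I := I) R
  set K := T.cost I R with hKdef
  -- `Y` bounds the cost of the matched solution, and `E` is the matching cost plus the cost `12γ *
  -- Y` of the purchase. The exceptions number at most `n`, and at most the unmatched requests plus
  -- `2γ` times the unmatched predictions.
  have hB := run_B_le (k := ⌊(1 + 2 * γ) * x⌋₊) (Y := K + D)
    (E := D + 12 * γ * (K + D)) hγ hPC hr hT (by linarith)
    (cost_matchedSolution_le (R := R) σ hT) (by positivity) (by
      intro P hP1 hP2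
      rw [unsatisfied_matchedSolution] at hP1
      obtain ⟨A, e, h1, h2, h3, h4⟩ := closeToAllBut_of_matching (R := R) (Rhat := Rhat) σ P
        (k := ⌊(1 + 2 * γ) * x⌋₊) (by
          apply Nat.le_floor
          rw [hx, mul_min_of_nonneg _ _ (by positivity)]
          push_cast
          have : (0 : ℝ) ≤ γ * Mᶜ.card := by positivity
          have : (0 : ℝ) ≤ γ * n := by positivity
          have : (0 : ℝ) ≤ Mhatᶜ.card := by positivity
          apply min_le_min <;> linarith)
      exact ⟨A, e, h1, h2, h3, h4.trans (by linarith)⟩)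
  have hH := harmonic_floor_le hγ hx0
  have hl := half_le_log_add_two hx0
  set l := Real.log (x + 2)
  refine (uflAlgorithm_cost_le_run hγ hr).trans ?_
  rw [mul_assoc]
  refine mul_le_mul_of_nonneg_left (hB.trans ?_) (by positivity)
  -- The bound becomes `(22 + 96γ + 12l) * K + (10 + 72γ) * D`; with `K ≤ 2 * l * K` the first
  -- coefficient is at most `(56 + 192γ) * l`.
  have h1 := mul_le_mul_of_nonneg_right hH hK
  have h2 : K * (1 / 2) ≤ K * l := by gcongr
  have h3 : γ * (K * (1 / 2)) ≤ γ * (K * l) := by gcongr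
  have h4 : 0 ≤ γ * D := by positivity
  linarith

/-! ### Distances in the reduced graph -/

namespace SoftCapInstance

variable {V : Type*} [Fintype V] (I : SoftCapInstance V)

theorem mem_reduction_sites {x : V ⊕ V} : x ∈ I.reduction.sites ↔ ∃ v, x = .inr v := by
  simp [reduction, eq_comm]

theorem reduction_dist_inl_inl_le (u v : V) :
    I.reduction.dist (.inl u) (.inl v) ≤ I.dist u v := by
  have := I.sub_le_dist (fun x => I.reduction.dist (.inl x) (.inl v)) (fun x y h => by
    have h1 := I.reduction.dist_triangle (.inl x) (.inl y) (.inl v)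
    have h2 : I.reduction.dist (.inl x) (.inl y) ≤ I.cost x y :=
      I.reduction.dist_le_cost (u := .inl x) (v := .inl y) h
    linarith) u v
  rwa [I.reduction.dist_self, sub_zero] at this

theorem reduction_dist_inl_inr_le (u v : V) :
    I.reduction.dist (.inl u) (.inr v) ≤ I.dist u v + I.openCost v / I.capacity v := by
  have h1 := I.reduction.dist_triangle (.inl u) (.inl v) (.inr v)
  have h2 := I.reduction_dist_inl_inl_le u v
  have h3 : I.reduction.dist (.inl v) (.inr v) ≤ I.openCost v / I.capacity v :=
    I.reduction.dist_le_cost (u := .inl v) (v := .inr v) rfl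
  linarith

/-- Copies are dead ends, so they create no shortcuts, and `v'` is entered only through `(v, v')`.
This is certified by a potential: the distance to `v` of the underlying vertex, plus the cost of
that edge everywhere except at `v'`. -/
theorem le_reduction_dist_inl_inr (u v : V) :
    I.dist u v + I.openCost v / I.capacity v ≤ I.reduction.dist (.inl u) (.inr v) := by
  classical
  have hq : 0 ≤ I.openCost v / I.capacity v :=
    div_nonneg (I.openCost_pos v).le (Nat.cast_nonneg _)
  have := I.reduction.sub_le_dist (fun x => I.dist (Sum.elim id id x) v +
    if x = .inr v then 0 else I.openCost v / I.capacity v) ?_ (.inl u) (.inr v)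
  · simpa [I.dist_self] using this
  rintro (x | x) (y | y) h
  · have h1 := I.dist_triangle x y v
    have h2 := I.dist_le_cost (u := x) (v := y) h
    change _ ≤ I.cost x y
    simp only [Sum.elim_inl, id_eq, reduceCtorEq, if_false]
    linarith
  · obtain rfl : x = y := h
    change _ ≤ I.openCost x / I.capacity x
    by_cases hx : x = v
    · simp [hx]
    · simpa [hx] using div_nonneg (I.openCost_pos x).le (Nat.cast_nonneg (I.capacity x))
  · obtain rfl : x = y := h
    change _ ≤ I.openCost x / I.capacity x
    have := div_nonneg (I.openCost_pos x).le (Nat.cast_nonneg (I.capacity x))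
    by_cases hx : x = v
    · subst hx
      simp only [Sum.elim_inl, Sum.elim_inr, id_eq, reduceCtorEq, if_false, if_true]
      linarith
    · simpa [hx] using this
  · exact h.elim

end SoftCapInstance

/-! ### Comparing the optima -/

section Optimum

variable {W : Type*} {n : ℕ}

theorem UFLInstance.opt_le (I : UFLInstance W) {R : Fin n → W} {T : UFLSolution W n}
    (hT : T.Feasible I) : I.opt R ≤ T.cost I R :=
  csInf_le ⟨0, by rintro _ ⟨T, -, rfl⟩; exact T.cost_nonneg R⟩ ⟨T, hT, rfl⟩

theorem SoftCapInstance.exists_feasible {V : Type*} (I : SoftCapInstance V) (n : ℕ) :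
    ∃ T : SoftCapSolution V n, T.Feasible I := by
  obtain ⟨v₀⟩ := I.connected.nonempty
  refine ⟨⟨fun _ => n, fun _ => v₀⟩, fun v => ?_⟩
  refine (Finset.card_le_univ _).trans ?_
  rw [Fintype.card_fin]
  exact Nat.le_mul_of_pos_right n (I.capacity_pos v)

variable {V : Type*} [Fintype V] (I : SoftCapInstance V)

/-- The optimum is an infimum and need not be known to be attained; a feasible solution is needed
because `sInf ∅ = 0`. -/
theorem SoftCapInstance.le_mul_opt {R : Fin n → V} {a b : ℝ} (hb : 0 < b)
    (h : ∀ T : SoftCapSolution V n, T.Feasible I → a ≤ b * T.cost I R) : a ≤ b * I.opt R := by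
  rw [← div_le_iff₀' hb]
  obtain ⟨T₀, hT₀⟩ := I.exists_feasible n
  refine le_csInf ⟨_, T₀, hT₀, rfl⟩ ?_
  rintro _ ⟨T, hT, rfl⟩
  rw [div_le_iff₀' hb]
  exact h T hT

open scoped Classical in
/-- The sum over all requests of the share of the opening cost at their facility. -/
theorem sum_openCost_div (a : Fin n → V) :
    ∑ i, I.openCost (a i) / I.capacity (a i) =
      ∑ v, ((Finset.univ.filter fun i => a i = v).card : ℝ) * (I.openCost v / I.capacity v) := by
  rw [← Finset.sum_fiberwise (Finset.univ : Finset (Fin n)) a]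
  refine Finset.sum_congr rfl fun v _ => ?_
  rw [← nsmul_eq_mul, ← Finset.sum_const]
  exact Finset.sum_congr rfl fun i hi => by rw [(Finset.mem_filter.1 hi).2]

/-- A soft-capacitated solution gives a solution of the reduced instance of at most twice the
cost. -/
theorem exists_reduction_solution (R : Fin n → V) {T : SoftCapSolution V n} (hT : T.Feasible I) :
    ∃ T' : UFLSolution (V ⊕ V) n, T'.Feasible I.reduction ∧
      T'.cost I.reduction (Sum.inl ∘ R) ≤ 2 * T.cost I R := by
  classical
  -- Open one copy per used vertex. Both the opening costs (`h1`) and the total cost of the new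
  -- edges (`h2`) are at most the opening costs of `T`.
  refine ⟨⟨(Finset.univ.image T.assign).map Function.Embedding.inr, fun i => .inr (T.assign i)⟩,
    ⟨fun x hx => ?_, fun i => ?_⟩, ?_⟩
  · obtain ⟨v, -, rfl⟩ := Finset.mem_map.1 hx
    exact I.mem_reduction_sites.2 ⟨v, rfl⟩
  · simp
  have hcap : ∀ v, (0 : ℝ) < I.capacity v := fun v => by exact_mod_cast I.capacity_pos v
  have h1 : ∑ v ∈ Finset.univ.image T.assign, I.openCost v ≤
      ∑ v, (T.copies v : ℝ) * I.openCost v := by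
    calc ∑ v ∈ Finset.univ.image T.assign, I.openCost v
        ≤ ∑ v ∈ Finset.univ.image T.assign, (T.copies v : ℝ) * I.openCost v := by
          refine Finset.sum_le_sum fun v hv => le_mul_of_one_le_left (I.openCost_pos v).le ?_
          obtain ⟨i, -, hi⟩ := Finset.mem_image.1 hv
          have hpos : 0 < (Finset.univ.filter fun i => T.assign i = v).card :=
            Finset.card_pos.2 ⟨i, by simpa⟩
          have := Nat.pos_of_mul_pos_right (hpos.trans_le (hT v))
          exact_mod_cast this
      _ ≤ _ := Finset.sum_le_sum_of_subset_of_nonneg (Finset.subset_univ _) fun v _ _ =>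
          mul_nonneg (Nat.cast_nonneg _) (I.openCost_pos v).le
  have h2 : ∑ i, I.openCost (T.assign i) / I.capacity (T.assign i) ≤
      ∑ v, (T.copies v : ℝ) * I.openCost v := by
    rw [sum_openCost_div]
    refine Finset.sum_le_sum fun v _ => ?_
    rw [← mul_div_assoc, div_le_iff₀ (hcap v), mul_right_comm]
    refine mul_le_mul_of_nonneg_right ?_ (I.openCost_pos v).le
    exact_mod_cast hT v
  have h3 : ∑ i, I.reduction.dist (.inl (R i)) (.inr (T.assign i)) ≤
      ∑ i, I.dist (R i) (T.assign i) +
        ∑ i, I.openCost (T.assign i) / I.capacity (T.assign i) := by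
    rw [← Finset.sum_add_distrib]
    exact Finset.sum_le_sum fun i _ => I.reduction_dist_inl_inr_le _ _
  have h4 : 0 ≤ ∑ i, I.dist (R i) (T.assign i) := Finset.sum_nonneg fun _ _ => I.dist_nonneg _ _
  unfold UFLSolution.cost SoftCapSolution.cost
  rw [Finset.sum_map]
  change ∑ v ∈ Finset.univ.image T.assign, I.openCost v +
    ∑ i, I.reduction.dist (.inl (R i)) (.inr (T.assign i)) ≤ _
  linarith

theorem SoftCapInstance.reduction_opt_le (R : Fin n → V) :
    I.reduction.opt (Sum.inl ∘ R : Fin n → V ⊕ V) ≤ 2 * I.opt R :=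
  I.le_mul_opt two_pos fun _ hT => by
    obtain ⟨T', hT', hle⟩ := exists_reduction_solution I R hT
    exact (I.reduction.opt_le hT').trans hle

end Optimum

/-! ### The soft-capacitated algorithm -/

section SoftCapAlgorithm

variable {V : Type*} [Fintype V] (I : SoftCapInstance V) (PC : PCAlgorithm I.reduction) (γ : ℝ)
  {m : ℕ} (Rhat : Fin m → V) {n : ℕ} (R : Fin n → V)

/-- The open facilities of the reduced instance after `t` requests. -/
noncomputable def reducedOpen (t : ℕ) : Finset (V ⊕ V) :=
  (frameworkState I.reduction PC γ (Sum.inl ∘ Rhat) (Sum.inl ∘ R) t).S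

theorem inr_softCapTarget (i : Fin n) :
    Sum.inr (softCapTarget I PC γ Rhat R i) = (reducedAlgorithm I PC γ Rhat R).assign i := by
  obtain ⟨h1, h2⟩ := uflAlgorithm_feasible PC γ (Sum.inl ∘ Rhat) (Sum.inl ∘ R)
  obtain ⟨v, hv⟩ := I.mem_reduction_sites.1 (h1 (h2 i))
  change (reducedAlgorithm I PC γ Rhat R).assign i = _ at hv
  rw [softCapTarget, hv]
  rfl

theorem inr_softCapTarget_mem (i : Fin n) :
    Sum.inr (softCapTarget I PC γ Rhat R i) ∈ reducedOpen I PC γ Rhat R (i + 1) := by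
  rw [inr_softCapTarget]
  exact frameworkTarget_mem _ i

open scoped Classical in
theorem softCapState_succ {t : ℕ} (h : t < n) :
    ∃ δ : V → ℕ,
      (∀ v, Sum.inr v ∈ reducedOpen I PC γ Rhat R (t + 1) →
        Sum.inr v ∉ reducedOpen I PC γ Rhat R t → δ v = 1) ∧
      (∀ v, ¬ (Sum.inr v ∈ reducedOpen I PC γ Rhat R (t + 1) ∧
        Sum.inr v ∉ reducedOpen I PC γ Rhat R t) → δ v = 0) ∧
      softCapState I PC γ Rhat R (t + 1) =
        let a := fun v => (softCapState I PC γ Rhat R t).1 v + δ v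
        let b := (softCapState I PC γ Rhat R t).2
        let x := softCapTarget I PC γ Rhat R ⟨t, h⟩
        (if a x * I.capacity x ≤ b x then Function.update a x (a x + 1) else a,
          Function.update b x (b x + 1)) :=
  ⟨_, fun _ h1 h2 => if_pos ⟨h1, h2⟩, fun _ h' => if_neg h', dif_pos h⟩

open scoped Classical in
/-- Invariants of the algorithm for the soft-capacitated problem. -/
theorem softCapState_spec {t : ℕ} (ht : t ≤ n) (v : V) :
    (softCapState I PC γ Rhat R t).2 v ≤ (softCapState I PC γ Rhat R t).1 v * I.capacity v ∧
    (softCapState I PC γ Rhat R t).1 v * I.capacity v ≤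
      (if Sum.inr v ∈ reducedOpen I PC γ Rhat R t then I.capacity v else 0) +
        (softCapState I PC γ Rhat R t).2 v ∧
    (softCapState I PC γ Rhat R t).2 v =
      (Finset.univ.filter fun i : Fin n => (i : ℕ) < t ∧ softCapTarget I PC γ Rhat R i = v).card := by
  induction t with
  | zero => simp [softCapState]
  | succ t ih =>
    obtain ⟨h1, h2, h3⟩ := ih (by omega)
    have htn : t < n := ht
    have hmem := inr_softCapTarget_mem I PC γ Rhat R ⟨t, htn⟩
    have hmono : Sum.inr v ∈ reducedOpen I PC γ Rhat R t →
        Sum.inr v ∈ reducedOpen I PC γ Rhat R (t + 1) :=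
      fun h => frameworkState_S_subset _ (Nat.le_succ t) ht h
    have hcount : (Finset.univ.filter fun i : Fin n =>
        (i : ℕ) < t + 1 ∧ softCapTarget I PC γ Rhat R i = v).card =
        (Finset.univ.filter fun i : Fin n =>
          (i : ℕ) < t ∧ softCapTarget I PC γ Rhat R i = v).card +
        if softCapTarget I PC γ Rhat R ⟨t, htn⟩ = v then 1 else 0 := by
      split_ifs with hv
      · rw [← Finset.card_insert_of_notMem (a := (⟨t, htn⟩ : Fin n)) (by simp)]
        congr 1
        ext i
        simp only [Finset.mem_filter, Finset.mem_univ, true_and, Finset.mem_insert, Fin.ext_iff]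
        constructor
        · rintro ⟨h, h'⟩
          by_cases hi : (i : ℕ) = t
          · exact Or.inl hi
          · exact Or.inr ⟨by omega, h'⟩
        · rintro (h | ⟨h, h'⟩)
          · obtain rfl : i = ⟨t, htn⟩ := Fin.ext h
            exact ⟨Nat.lt_succ_self t, hv⟩
          · exact ⟨by omega, h'⟩
      · rw [add_zero]
        congr 1
        ext i
        simp only [Finset.mem_filter, Finset.mem_univ, true_and]
        refine ⟨fun ⟨h, h'⟩ => ⟨?_, h'⟩, fun ⟨h, h'⟩ => ⟨by omega, h'⟩⟩
        rcases Nat.lt_succ_iff_lt_or_eq.1 h with h | h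
        · exact h
        · obtain rfl : i = ⟨t, htn⟩ := Fin.ext h
          exact absurd h' hv
    rw [hcount, ← h3]
    have hcap := I.capacity_pos v
    obtain ⟨δ, hδ1, hδ0, e⟩ := softCapState_succ I PC γ Rhat R htn
    replace hδ1 := hδ1 v
    replace hδ0 := hδ0 v
    rw [e]
    dsimp only
    generalize (softCapState I PC γ Rhat R t).1 = a at h1 h2 ⊢
    generalize (softCapState I PC γ Rhat R t).2 = b at h1 h2 ⊢
    -- A newly opened `v'` adds one capacity to both sides of the second invariant.
    have h4 : δ v * I.capacity v + (if Sum.inr v ∈ reducedOpen I PC γ Rhat R t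
        then I.capacity v else 0) =
        if Sum.inr v ∈ reducedOpen I PC γ Rhat R (t + 1) then I.capacity v else 0 := by
      split_ifs with hS hS' hS'
      · rw [hδ0 fun h => h.2 hS, zero_mul, zero_add]
      · exact absurd (hmono hS) hS'
      · rw [hδ1 hS' hS, one_mul, add_zero]
      · rw [hδ0 fun h => hS' h.1, zero_mul]
    rw [← h4]
    -- If all facilities at the target are full, one more adds a capacity, which the open `v'`
    -- allows for; otherwise there is room for one more request.
    by_cases hx : softCapTarget I PC γ Rhat R ⟨t, htn⟩ = v
    · rw [hx] at hmem ⊢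
      rw [if_pos hmem] at h4
      rw [Function.update_self, if_pos rfl]
      refine ⟨?_, ?_, rfl⟩ <;> split_ifs with hf <;>
        simp only [Function.update_self, add_mul, one_mul] at hf ⊢ <;> split_ifs at h2 h4 ⊢ <;>
        omega
    · have hvx : v ≠ softCapTarget I PC γ Rhat R ⟨t, htn⟩ := fun h => hx h.symm
      rw [Function.update_of_ne hvx, if_neg hx, add_zero]
      have e1 : ∀ (p : Prop) [Decidable p] (c : V → ℕ) (y : ℕ),
          (if p then Function.update c (softCapTarget I PC γ Rhat R ⟨t, htn⟩) y else c) v =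
            c v := by
        intro p _ c y
        split_ifs
        · exact Function.update_of_ne hvx _ _
        · rfl
      rw [e1, add_mul]
      exact ⟨by omega, by omega, rfl⟩

open scoped Classical in
theorem softCapAlgorithm_spec (v : V) :
    (Finset.univ.filter fun i => softCapTarget I PC γ Rhat R i = v).card ≤
      (softCapAlgorithm I PC γ Rhat R).copies v * I.capacity v ∧
    (softCapAlgorithm I PC γ Rhat R).copies v * I.capacity v ≤
      (if Sum.inr v ∈ (reducedAlgorithm I PC γ Rhat R).opened then I.capacity v else 0) +
        (Finset.univ.filter fun i => softCapTarget I PC γ Rhat R i = v).card := by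
  obtain ⟨h1, h2, h3⟩ := softCapState_spec I PC γ Rhat R le_rfl v
  simp only [Fin.is_lt, true_and] at h3
  rw [h3] at h1 h2
  exact ⟨h1, h2⟩

theorem softCapAlgorithm_feasible : (softCapAlgorithm I PC γ Rhat R).Feasible I :=
  fun v => (softCapAlgorithm_spec I PC γ Rhat R v).1

/-- Multiply the second bound of `softCapAlgorithm_spec` by `f_v / β_v`: the load then pays exactly
what its requests pay for the edge `(v, v')`, and the remaining facility is the opening of `v'`. -/
theorem softCapAlgorithm_cost_le :
    (softCapAlgorithm I PC γ Rhat R).cost I R ≤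
      (reducedAlgorithm I PC γ Rhat R).cost I.reduction (Sum.inl ∘ R) := by
  classical
  have hcap : ∀ v, (0 : ℝ) < I.capacity v := fun v => by exact_mod_cast I.capacity_pos v
  set T := reducedAlgorithm I PC γ Rhat R with hT
  have hsub : T.opened ⊆ I.reduction.sites :=
    (uflAlgorithm_feasible PC γ (Sum.inl ∘ Rhat) (Sum.inl ∘ R)).1
  have h1 : ∑ v, ((softCapAlgorithm I PC γ Rhat R).copies v : ℝ) * I.openCost v ≤
      (∑ v, if Sum.inr v ∈ T.opened then I.openCost v else 0) +
        ∑ i, I.openCost (softCapTarget I PC γ Rhat R i) /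
          I.capacity (softCapTarget I PC γ Rhat R i) := by
    rw [sum_openCost_div, ← Finset.sum_add_distrib]
    refine Finset.sum_le_sum fun v _ => ?_
    have h := (softCapAlgorithm_spec I PC γ Rhat R v).2
    have h' : ((softCapAlgorithm I PC γ Rhat R).copies v : ℝ) * I.capacity v ≤
        (if Sum.inr v ∈ T.opened then (I.capacity v : ℝ) else 0) +
        (Finset.univ.filter fun i => softCapTarget I PC γ Rhat R i = v).card := by
      exact_mod_cast h
    have h2 := mul_le_mul_of_nonneg_right h' (div_nonneg (I.openCost_pos v).le (hcap v).le)
    have h3 : ((softCapAlgorithm I PC γ Rhat R).copies v : ℝ) * I.capacity v *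
        (I.openCost v / I.capacity v) =
        (softCapAlgorithm I PC γ Rhat R).copies v * I.openCost v := by
      rw [mul_assoc, mul_div_cancel₀ _ (hcap v).ne']
    rw [h3, add_mul] at h2
    refine h2.trans (le_of_eq ?_)
    congr 1
    split_ifs
    · rw [mul_div_cancel₀ _ (hcap v).ne']
    · rw [zero_mul]
  have h2 : (∑ v, if Sum.inr v ∈ T.opened then I.openCost v else 0) =
      ∑ x ∈ T.opened, I.reduction.openCost x := by
    rw [← Finset.sum_filter]
    refine Finset.sum_bij (fun v _ => Sum.inr v) (fun v hv => (Finset.mem_filter.1 hv).2)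
      (fun _ _ _ _ h => Sum.inr.inj h) (fun x hx => ?_) fun _ _ => rfl
    obtain ⟨v, rfl⟩ := I.mem_reduction_sites.1 (hsub hx)
    exact ⟨v, by simpa using hx, rfl⟩
  have h3 : ∑ i, I.dist (R i) (softCapTarget I PC γ Rhat R i) +
      ∑ i, I.openCost (softCapTarget I PC γ Rhat R i) /
        I.capacity (softCapTarget I PC γ Rhat R i) ≤
      ∑ i, I.reduction.dist (.inl (R i)) (T.assign i) := by
    rw [← Finset.sum_add_distrib]
    refine Finset.sum_le_sum fun i _ => ?_
    rw [hT, ← inr_softCapTarget]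
    exact I.le_reduction_dist_inl_inr _ _
  change ∑ v, ((softCapAlgorithm I PC γ Rhat R).copies v : ℝ) * I.openCost v +
    ∑ i, I.dist (R i) (softCapTarget I PC γ Rhat R i) ≤
    ∑ x ∈ T.opened, I.reduction.openCost x + ∑ i, I.reduction.dist (.inl (R i)) (T.assign i)
  linarith

end SoftCapAlgorithm

/-! ### The main theorem -/

theorem mainTheorem4 (γ : ℝ) (hγ : 1 ≤ γ) :
    ∃ C : ℝ, 0 < C ∧
      ∀ (V : Type*) [Fintype V] (I : SoftCapInstance V)
        (PC : PCAlgorithm I.reduction), PC.IsApprox γ →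
      ∀ (m : ℕ) (Rhat : Fin m → V) (n : ℕ) (R : Fin n → V),
        (softCapAlgorithm I PC γ Rhat R).Feasible I ∧
        (reducedAlgorithm I PC γ Rhat R).Feasible I.reduction ∧
        (softCapAlgorithm I PC γ Rhat R).cost I R ≤
          (reducedAlgorithm I PC γ Rhat R).cost I.reduction (Sum.inl ∘ R) ∧
        I.reduction.opt (Sum.inl ∘ R : Fin n → V ⊕ V) ≤ 2 * I.opt R ∧
        ∀ (Δ : ℕ) (D : ℝ), IsMetricError I.toNetwork R Rhat Δ D →
          (softCapAlgorithm I PC γ Rhat R).cost I R ≤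
            C * Real.log (min (n : ℝ) (Δ : ℝ) + 2) * I.opt R + C * D := by
  have hC : 0 < (1 + 6 * γ) * (56 + 192 * γ) := by positivity
  refine ⟨2 * ((1 + 6 * γ) * (56 + 192 * γ)), by positivity, ?_⟩
  intro V _ I PC hPC m Rhat n R
  refine ⟨softCapAlgorithm_feasible I PC γ Rhat R, uflAlgorithm_feasible PC γ _ _,
    softCapAlgorithm_cost_le I PC γ Rhat R, I.reduction_opt_le R, ?_⟩
  rintro Δ D ⟨M, Mhat, -, ⟨⟨σ, rfl⟩, -⟩, rfl⟩
  set C := (1 + 6 * γ) * (56 + 192 * γ)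
  set D := ∑ x : M, I.dist (R x) (Rhat (σ x))
  have hD0 : 0 ≤ D := Finset.sum_nonneg fun _ _ => I.dist_nonneg _ _
  have hl := half_le_log_add_two (x := min (n : ℝ) ((Mᶜ.card + Mhatᶜ.card : ℕ) : ℝ))
    (le_min (Nat.cast_nonneg _) (Nat.cast_nonneg _))
  set l := Real.log (min (n : ℝ) ((Mᶜ.card + Mhatᶜ.card : ℕ) : ℝ) + 2)
  have hl0 : 0 < l := by linarith
  -- With `C * D` on the left, a bound against every feasible `T` passes to the infimum. The factor
  -- 2 in the constant is the loss of the reduction.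
  rw [← sub_le_iff_le_add]
  refine I.le_mul_opt (by positivity) fun T hT => ?_
  obtain ⟨T', hT', hle⟩ := exists_reduction_solution I R hT
  have h1 := uflAlgorithm_cost_le (Rhat := Sum.inl ∘ Rhat) (R := Sum.inl ∘ R) hγ hPC σ hT'
  -- The same matching serves in the reduced graph, where distances between old vertices are no
  -- larger.
  have h2 : ∑ x : M, I.reduction.dist ((Sum.inl ∘ R : Fin n → V ⊕ V) x)
      ((Sum.inl ∘ Rhat : Fin m → V ⊕ V) (σ x)) ≤ D :=
    Finset.sum_le_sum fun x _ => I.reduction_dist_inl_inl_le _ _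
  have h3 : C * (l * T'.cost I.reduction (Sum.inl ∘ R) +
      ∑ x : M, I.reduction.dist ((Sum.inl ∘ R : Fin n → V ⊕ V) x)
        ((Sum.inl ∘ Rhat : Fin m → V ⊕ V) (σ x))) ≤ C * (l * (2 * T.cost I R) + D) := by
    gcongr
  have h4 : 0 ≤ C * D := by positivity
  have h5 := (softCapAlgorithm_cost_le I PC γ Rhat R).trans (h1.trans h3)
  linarith
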